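/- Let $G$ be a (finite-dimensional, real) Lie group with Lie algebra $\mathfrak g=T_1G$, and let $\pi:P\to M$ be a smooth right principal $G$-bundle, with action $\psi_g(p)=p\cdot g$ and infinitesimal generators $u_P$ ($u\in\mathfrak g$). The gauge groupoid $\mathcal G(P)\rightrightarrows M$ is the quotient manifold $(P\times P)/G$ by the diagonal action, with classes $\overline{(p,q)}$, target $\overline{(p,q)}\mapsto\pi(p)$, source $\overline{(p,q)}\mapsto\pi(q)$ and multiplication $\overline{(p,q)}\cdot\overline{(q,r)}=\overline{(p,r)}$; its tangent groupoid $T\mathcal G(P)\rightrightarrows TM$ has as structure maps the tangent maps of those of $\mathcal G(P)$. For $X,Y\in TP$ let $\overline{(X,Y)}\in T\mathcal G(P)$ denote the image of $(X,Y)$ under the tangent map of the quotient map $P\times P\to\mathcal G(P)$. Let $V\subseteq TP$ be the vertical bundle, $V_p=\{u_P(p): u\in\mathfrak g\}$, and $\Delta_V=\{\overline{(X,Y)}: X,Y\in V\}\subseteq T\mathcal G(P)$. A vector-valued 1-form $K\in\Omega^1(\mathcal G(P),T\mathcal G(P))$ is a smooth vector bundle endomorphism $K:T\mathcal G(P)\to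 T\mathcal G(P)$ over the identity; it is multiplicative if there is $K_M\in\Omega^1(M,TM)$ such that $(K,K_M)$ is a morphism of the groupoid $T\mathcal G(P)\rightrightarrows TM$. A principal connection is a smooth $\theta\in\Omega^1(P,\mathfrak g)$ with $\theta(u_P)=u$ for all $u\in\mathfrak g$ and $\psi_g^*\theta=\mathrm{Ad}_{g^{-1}}\theta$ for all $g\in G$; put $\Theta(X)=(\theta(X))_P(p)$ for $X\in T_pP$. Then there is a one-to-one correspondence $\theta\mapsto K$ between the principal connections $\theta\in\Omega^1(P,\mathfrak g)$ on $P$ and the multiplicative vector-valued 1-forms $K\in\Omega^1(\mathcal G(P),T\mathcal G(P))$ that satisfy $K^2=K$ and $\mathrm{Im}(K)=\Delta_V$. It is given by $$K\big(\overline{(X,Y)}\big)=\overline{(\Theta(X),\Theta(Y))}\qquad\text{for all }X,Y\in TP .$$ -/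

import Mathlib

open Set Topology Bundle
open scoped Manifold ContDiff

noncomputable section

/-! ### Principal bundles -/

section PrincipalBundle

variable {EM : Type*} [NormedAddCommGroup EM] [NormedSpace ℝ EM]
  {HM : Type*} [TopologicalSpace HM] (IM : ModelWithCorners ℝ EM HM)
  {EP : Type*} [NormedAddCommGroup EP] [NormedSpace ℝ EP]
  {HP : Type*} [TopologicalSpace HP] (IP : ModelWithCorners ℝ EP HP)
  {EG : Type*} [NormedAddCommGroup EG] [NormedSpace ℝ EG]
  {HG : Type*} [TopologicalSpace HG] (IG : ModelWithCorners ℝ EG HG)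
  (M : Type*) [TopologicalSpace M] [ChartedSpace HM M]
  (P : Type*) [TopologicalSpace P] [ChartedSpace HP P]
  (G : Type*) [TopologicalSpace G] [ChartedSpace HG G] [Group G]

/-- A smooth (right) principal `G`-bundle `proj : P → M`: a smooth right action `act` of `G` on `P`
such that `M` is covered by open sets over which `P` admits a `G`-equivariant diffeomorphism onto
`baseSet × G` commuting with the projections (`G` acting on the second factor by right
multiplication). -/
structure PrincipalBundle where
  proj : P → M
  act : P → G → P
  act_one : ∀ p, act p 1 = p
  act_mul : ∀ p g h, act p (g * h) = act (act p g) h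
  contMDiff_act : ContMDiff (IP.prod IG) IP ∞ (fun z : P × G => act z.1 z.2)
  contMDiff_proj : ContMDiff IP IM ∞ proj
  proj_act : ∀ p g, proj (act p g) = proj p
  exists_trivialization : ∀ x : M, ∃ e : Trivialization G proj, x ∈ e.baseSet ∧
    ContMDiffOn IP (IM.prod IG) ∞ e e.source ∧
    ContMDiffOn (IM.prod IG) IP ∞ e.toOpenPartialHomeomorph.symm e.target ∧
    ∀ p ∈ e.source, ∀ g, e (act p g) = (proj p, (e p).2 * g)

end PrincipalBundle

/-! ### Vector-valued one-forms, groupoids and multiplicativity -/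

section Forms

variable {E : Type*} [NormedAddCommGroup E] [NormedSpace ℝ E]
  {H : Type*} [TopologicalSpace H] (I : ModelWithCorners ℝ E H)
  (N : Type*) [TopologicalSpace N] [ChartedSpace H N] [IsManifold I ∞ N]

/-- An element of `Ω¹(N, TN)`: a smooth endomorphism of the vector bundle `TN` covering the
identity of `N`. -/
@[ext]
structure VectorValuedOneForm where
  toFun : ∀ x : N, TangentSpace I x →L[ℝ] TangentSpace I x
  contMDiff_toFun : ContMDiff I.tangent I.tangent ∞
    (fun v : TangentBundle I N => (⟨v.1, toFun v.1 v.2⟩ : TangentBundle I N))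

variable {I N}

/-- The bundle map `TN → TN` given by a vector-valued one-form. -/
def VectorValuedOneForm.map (K : VectorValuedOneForm I N) (v : TangentBundle I N) :
    TangentBundle I N :=
  ⟨v.1, K.toFun v.1 v.2⟩

variable (I)

/-- The velocity at time `0` of a curve. -/
def velocity (γ : ℝ → N) : TangentBundle I N :=
  tangentMap 𝓘(ℝ, ℝ) I γ ⟨0, (1 : ℝ)⟩

end Forms

/-- A groupoid `𝒢 ⇉ M` with space of arrows `𝒢` and space of objects `M`. The product `g h` is
defined when `src g = tgt h`. -/
structure GroupoidStructure (M 𝒢 : Type*) where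
  src : 𝒢 → M
  tgt : 𝒢 → M
  mul : ∀ g h : 𝒢, src g = tgt h → 𝒢
  unit : M → 𝒢
  inv : 𝒢 → 𝒢
  src_mul : ∀ g h e, src (mul g h e) = src h
  tgt_mul : ∀ g h e, tgt (mul g h e) = tgt g
  src_unit : ∀ x, src (unit x) = x
  tgt_unit : ∀ x, tgt (unit x) = x
  src_inv : ∀ g, src (inv g) = tgt g
  tgt_inv : ∀ g, tgt (inv g) = src g
  mul_assoc : ∀ (g h k : 𝒢) (e₁ : src g = tgt h) (e₂ : src h = tgt k),
    mul (mul g h e₁) k ((src_mul g h e₁).trans e₂)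
      = mul g (mul h k e₂) (e₁.trans (tgt_mul h k e₂).symm)
  unit_mul : ∀ g, mul (unit (tgt g)) g (src_unit (tgt g)) = g
  mul_unit : ∀ g, mul g (unit (src g)) (tgt_unit (src g)).symm = g
  inv_mul : ∀ g, mul (inv g) g (src_inv g) = unit (src g)
  mul_inv : ∀ g, mul g (inv g) (tgt_inv g).symm = unit (tgt g)

section Multiplicative

variable {EM : Type*} [NormedAddCommGroup EM] [NormedSpace ℝ EM]
  {HM : Type*} [TopologicalSpace HM] {IM : ModelWithCorners ℝ EM HM}
  {E : Type*} [NormedAddCommGroup E] [NormedSpace ℝ E]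
  {H : Type*} [TopologicalSpace H] {I : ModelWithCorners ℝ E H}
  {M : Type*} [TopologicalSpace M] [ChartedSpace HM M] [IsManifold IM ∞ M]
  {𝒢 : Type*} [TopologicalSpace 𝒢] [ChartedSpace H 𝒢] [IsManifold I ∞ 𝒢]

variable (I) in
/-- The graph of the multiplication `Tm : T(𝒢⁽²⁾) → T𝒢` of the tangent groupoid: `(X, Y)` is the
velocity of a smooth curve `(γ, δ)` of composable pairs of arrows, and `Z = Tm (X, Y)` is the
velocity of the curve `t ↦ γ t · δ t`. -/
def GroupoidStructure.IsTangentMul (𝓖 : GroupoidStructure M 𝒢) (X Y Z : TangentBundle I 𝒢) :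
    Prop :=
  ∃ (γ δ : ℝ → 𝒢) (h : ∀ t, 𝓖.src (γ t) = 𝓖.tgt (δ t)),
    ContMDiff 𝓘(ℝ, ℝ) I ∞ γ ∧ ContMDiff 𝓘(ℝ, ℝ) I ∞ δ ∧
    velocity I γ = X ∧ velocity I δ = Y ∧
    velocity I (fun t => 𝓖.mul (γ t) (δ t) (h t)) = Z

variable (IM) in
/-- `K ∈ Ω¹(𝒢, T𝒢)` is multiplicative: there is `K_M ∈ Ω¹(M, TM)` such that `(K, K_M)` is a
morphism from the tangent groupoid `T𝒢 ⇉ TM` to itself. -/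
def GroupoidStructure.IsMultiplicative (𝓖 : GroupoidStructure M 𝒢)
    (K : VectorValuedOneForm I 𝒢) : Prop :=
  ∃ K_M : VectorValuedOneForm IM M,
    (∀ X, tangentMap I IM 𝓖.src (K.map X) = K_M.map (tangentMap I IM 𝓖.src X)) ∧
    (∀ X, tangentMap I IM 𝓖.tgt (K.map X) = K_M.map (tangentMap I IM 𝓖.tgt X)) ∧
    ∀ X Y Z, 𝓖.IsTangentMul I X Y Z → 𝓖.IsTangentMul I (K.map X) (K.map Y) (K.map Z)

end Multiplicative

namespace PrincipalBundle

variable {EM : Type*} [NormedAddCommGroup EM] [NormedSpace ℝ EM]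
  {HM : Type*} [TopologicalSpace HM] {IM : ModelWithCorners ℝ EM HM}
  {EP : Type*} [NormedAddCommGroup EP] [NormedSpace ℝ EP]
  {HP : Type*} [TopologicalSpace HP] {IP : ModelWithCorners ℝ EP HP}
  {EG : Type*} [NormedAddCommGroup EG] [NormedSpace ℝ EG]
  {HG : Type*} [TopologicalSpace HG] {IG : ModelWithCorners ℝ EG HG}
  {M : Type*} [TopologicalSpace M] [ChartedSpace HM M]
  {P : Type*} [TopologicalSpace P] [ChartedSpace HP P]
  {G : Type*} [TopologicalSpace G] [ChartedSpace HG G] [Group G]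

/-! ### The gauge groupoid as a set -/

section Algebra

variable (B : PrincipalBundle IM IP IG M P G)

theorem act_eq_self {p : P} {g : G} (h : B.act p g = p) : g = 1 := by
  obtain ⟨e, hx, -, -, he⟩ := B.exists_trivialization (B.proj p)
  have := he p (e.mem_source.2 hx) g
  rw [h] at this
  have h2 := congrArg Prod.snd this
  simpa using h2

theorem exists_act_eq {p q : P} (h : B.proj p = B.proj q) : ∃ g, B.act p g = q := by
  obtain ⟨e, hx, -, -, he⟩ := B.exists_trivialization (B.proj p)
  have hp : p ∈ e.source := e.mem_source.2 hx
  have hq : q ∈ e.source := e.mem_source.2 (h ▸ hx)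
  refine ⟨(e p).2⁻¹ * (e q).2, e.injOn (e.mem_source.2 ?_) hq ?_⟩
  · rwa [B.proj_act]
  · change e _ = e q
    rw [he p hp, mul_inv_cancel_left, h, e.mk_proj_snd hq]

/-- The orbit relation of the diagonal action of `G` on `P × P`. -/
def diagonalSetoid : Setoid (P × P) where
  r z w := ∃ g, w = (B.act z.1 g, B.act z.2 g)
  iseqv :=
    { refl := fun z => ⟨1, by simp [B.act_one]⟩
      symm := by
        rintro z w ⟨g, rfl⟩
        exact ⟨g⁻¹, by simp [← B.act_mul, B.act_one]⟩
      trans := by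
        rintro z w v ⟨g, rfl⟩ ⟨h, rfl⟩
        exact ⟨g * h, by simp [B.act_mul]⟩ }

/-- The space of arrows `𝒢(P) = (P × P) / G` of the gauge groupoid. -/
def GaugeSpace : Type _ := Quotient B.diagonalSetoid

/-- The quotient map `(p, q) ↦ \overline{(p, q)}`. -/
def toGauge (z : P × P) : B.GaugeSpace := Quotient.mk B.diagonalSetoid z

theorem toGauge_surjective : Function.Surjective B.toGauge := Quotient.mk_surjective

theorem toGauge_eq_iff {z w : P × P} :
    B.toGauge z = B.toGauge w ↔ ∃ g, w = (B.act z.1 g, B.act z.2 g) :=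
  ⟨fun h => Quotient.exact h, fun h => Quotient.sound h⟩

theorem toGauge_act (p q : P) (g : G) : B.toGauge (B.act p g, B.act q g) = B.toGauge (p, q) :=
  ((B.toGauge_eq_iff (z := (p, q))).2 ⟨g, rfl⟩).symm

/-- The target map `\overline{(p, q)} ↦ π p`. -/
def tgt : B.GaugeSpace → M :=
  Quotient.lift (fun z => B.proj z.1) (by rintro z w ⟨g, rfl⟩; exact (B.proj_act _ _).symm)

/-- The source map `\overline{(p, q)} ↦ π q`. -/
def src : B.GaugeSpace → M :=
  Quotient.lift (fun z => B.proj z.2) (by rintro z w ⟨g, rfl⟩; exact (B.proj_act _ _).symm)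

@[simp] theorem tgt_toGauge (z : P × P) : B.tgt (B.toGauge z) = B.proj z.1 := rfl

@[simp] theorem src_toGauge (z : P × P) : B.src (B.toGauge z) = B.proj z.2 := rfl

theorem exists_mul (z w : B.GaugeSpace) (h : B.src z = B.tgt w) :
    ∃ v, ∃ p q r, z = B.toGauge (p, q) ∧ w = B.toGauge (q, r) ∧ v = B.toGauge (p, r) := by
  obtain ⟨⟨p, q⟩, rfl⟩ := B.toGauge_surjective z
  obtain ⟨⟨q', r'⟩, rfl⟩ := B.toGauge_surjective w
  obtain ⟨g, rfl⟩ := B.exists_act_eq (p := q') (q := q) (by simpa using h.symm)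
  exact ⟨_, p, _, B.act r' g, rfl, (B.toGauge_act _ _ _).symm, rfl⟩

/-- The multiplication `\overline{(p, q)} · \overline{(q, r)} = \overline{(p, r)}`; see
`gaugeMul_toGauge`. -/
def gaugeMul (z w : B.GaugeSpace) (h : B.src z = B.tgt w) : B.GaugeSpace :=
  (B.exists_mul z w h).choose

theorem gaugeMul_toGauge (p q r : P) (h : B.src (B.toGauge (p, q)) = B.tgt (B.toGauge (q, r))) :
    B.gaugeMul (B.toGauge (p, q)) (B.toGauge (q, r)) h = B.toGauge (p, r) := by
  obtain ⟨p', q', r', h1, h2, h3⟩ := (B.exists_mul _ _ h).choose_spec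
  obtain ⟨g, hg⟩ := B.toGauge_eq_iff.1 h1
  obtain ⟨k, hk⟩ := B.toGauge_eq_iff.1 h2
  simp only [Prod.mk.injEq] at hg hk
  obtain ⟨rfl, rfl⟩ := hg
  obtain ⟨hq, rfl⟩ := hk
  have : g = k := by
    have : B.act q (g * k⁻¹) = q := by
      rw [B.act_mul, hq, ← B.act_mul, mul_inv_cancel, B.act_one]
    exact mul_inv_eq_one.1 (B.act_eq_self this)
  subst this
  exact h3.trans (B.toGauge_act _ _ _)

theorem exists_proj_eq (x : M) : ∃ p, B.proj p = x := by
  obtain ⟨e, hx, -⟩ := B.exists_trivialization x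
  exact ⟨_, e.proj_symm_apply' (x := (1 : G)) hx⟩

theorem toGauge_diag {p q : P} (h : B.proj p = B.proj q) : B.toGauge (p, p) = B.toGauge (q, q) := by
  obtain ⟨g, rfl⟩ := B.exists_act_eq h
  exact (B.toGauge_act _ _ _).symm

/-- The unit map `x ↦ \overline{(p, p)}`, where `π p = x`. -/
def gaugeUnit (x : M) : B.GaugeSpace :=
  B.toGauge ((B.exists_proj_eq x).choose, (B.exists_proj_eq x).choose)

theorem gaugeUnit_proj (p : P) : B.gaugeUnit (B.proj p) = B.toGauge (p, p) :=
  B.toGauge_diag (B.exists_proj_eq (B.proj p)).choose_spec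

/-- The inversion `\overline{(p, q)} ↦ \overline{(q, p)}`. -/
def gaugeInv : B.GaugeSpace → B.GaugeSpace :=
  Quotient.lift (fun z => B.toGauge (z.2, z.1))
    (by rintro z w ⟨g, rfl⟩; exact (B.toGauge_act _ _ _).symm)

@[simp] theorem gaugeInv_toGauge (p q : P) : B.gaugeInv (B.toGauge (p, q)) = B.toGauge (q, p) := rfl

/-- The gauge groupoid `𝒢(P) ⇉ M`. -/
def gaugeGroupoid : GroupoidStructure M B.GaugeSpace where
  src := B.src
  tgt := B.tgt
  mul := B.gaugeMul
  unit := B.gaugeUnit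
  inv := B.gaugeInv
  src_mul z w h := by
    obtain ⟨-, p, q, r, rfl, rfl, -⟩ := B.exists_mul z w h
    rw [B.gaugeMul_toGauge]; rfl
  tgt_mul z w h := by
    obtain ⟨-, p, q, r, rfl, rfl, -⟩ := B.exists_mul z w h
    rw [B.gaugeMul_toGauge]; rfl
  src_unit x := by
    obtain ⟨p, rfl⟩ := B.exists_proj_eq x
    rw [B.gaugeUnit_proj]; rfl
  tgt_unit x := by
    obtain ⟨p, rfl⟩ := B.exists_proj_eq x
    rw [B.gaugeUnit_proj]; rfl
  src_inv z := by obtain ⟨z, rfl⟩ := B.toGauge_surjective z; rfl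
  tgt_inv z := by obtain ⟨z, rfl⟩ := B.toGauge_surjective z; rfl
  mul_assoc z w v h₁ h₂ := by
    obtain ⟨-, p, q, r, rfl, rfl, -⟩ := B.exists_mul z w h₁
    obtain ⟨⟨r', s'⟩, rfl⟩ := B.toGauge_surjective v
    obtain ⟨g, rfl⟩ := B.exists_act_eq (p := r') (q := r) (by simpa using h₂.symm)
    simp only [← B.toGauge_act r' s' g, B.gaugeMul_toGauge]
  unit_mul z := by
    obtain ⟨⟨p, q⟩, rfl⟩ := B.toGauge_surjective z
    simp only [B.tgt_toGauge, B.gaugeUnit_proj, B.gaugeMul_toGauge]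
  mul_unit z := by
    obtain ⟨⟨p, q⟩, rfl⟩ := B.toGauge_surjective z
    simp only [B.src_toGauge, B.gaugeUnit_proj, B.gaugeMul_toGauge]
  inv_mul z := by
    obtain ⟨⟨p, q⟩, rfl⟩ := B.toGauge_surjective z
    simp only [B.src_toGauge, B.gaugeUnit_proj, B.gaugeMul_toGauge, B.gaugeInv_toGauge]
  mul_inv z := by
    obtain ⟨⟨p, q⟩, rfl⟩ := B.toGauge_surjective z
    simp only [B.tgt_toGauge, B.gaugeUnit_proj, B.gaugeMul_toGauge, B.gaugeInv_toGauge]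

end Algebra

/-! ### The smooth structure of the gauge groupoid -/

section Smooth

variable (B : PrincipalBundle IM IP IG M P G)

/-- The quotient topology. -/
instance : TopologicalSpace B.GaugeSpace :=
  inferInstanceAs (TopologicalSpace (Quotient B.diagonalSetoid))

theorem continuous_toGauge : Continuous B.toGauge := continuous_quotient_mk'

theorem continuous_act_right (g : G) : Continuous (fun p => B.act p g) :=
  B.contMDiff_act.continuous.comp (Continuous.prodMk_left g)

theorem isOpenQuotientMap_toGauge : IsOpenQuotientMap B.toGauge := by
  refine ⟨B.toGauge_surjective, B.continuous_toGauge, fun U hU => ?_⟩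
  change IsOpen (B.toGauge ⁻¹' (B.toGauge '' U))
  have : B.toGauge ⁻¹' (B.toGauge '' U) = ⋃ g : G, (fun z : P × P => (B.act z.1 g, B.act z.2 g)) ⁻¹' U := by
    ext z
    simp only [mem_preimage, mem_image, mem_iUnion]
    constructor
    · rintro ⟨w, hw, h⟩
      obtain ⟨g, rfl⟩ := B.toGauge_eq_iff.1 h.symm
      exact ⟨g, hw⟩
    · rintro ⟨g, hg⟩
      exact ⟨_, hg, B.toGauge_act _ _ _⟩
  rw [this]
  refine isOpen_iUnion fun g => hU.preimage ?_
  exact ((B.continuous_act_right g).comp continuous_fst).prodMk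
    ((B.continuous_act_right g).comp continuous_snd)

theorem continuous_src : Continuous B.src :=
  B.isOpenQuotientMap_toGauge.continuous_comp_iff.1
    (B.contMDiff_proj.continuous.comp continuous_snd)

theorem continuous_tgt : Continuous B.tgt :=
  B.isOpenQuotientMap_toGauge.continuous_comp_iff.1
    (B.contMDiff_proj.continuous.comp continuous_fst)

/-- A smooth equivariant local trivialization of the principal bundle. -/
structure LocalTriv extends Trivialization G B.proj where
  contMDiffOn_toFun : ContMDiffOn IP (IM.prod IG) ∞ toOpenPartialHomeomorph
    toOpenPartialHomeomorph.source
  contMDiffOn_symm : ContMDiffOn (IM.prod IG) IP ∞ toOpenPartialHomeomorph.symm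
    toOpenPartialHomeomorph.target
  map_act : ∀ p ∈ toOpenPartialHomeomorph.source, ∀ g,
    toOpenPartialHomeomorph (act B p g) = (proj B p, (toOpenPartialHomeomorph p).2 * g)

variable {B}

/-- The section `x ↦ e⁻¹(x, a)`. -/
def LocalTriv.sec (e : B.LocalTriv) (x : M) (a : G) : P := e.toOpenPartialHomeomorph.symm (x, a)

/-- The `G`-component of the trivialization. -/
def LocalTriv.fib (e : B.LocalTriv) (p : P) : G := (e.toOpenPartialHomeomorph p).2

theorem LocalTriv.fib_act (e : B.LocalTriv) {p : P} (hp : B.proj p ∈ e.baseSet) (g : G) :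
    e.fib (B.act p g) = e.fib p * g :=
  congrArg Prod.snd (e.map_act p (e.toTrivialization.mem_source.2 hp) g)

theorem LocalTriv.proj_sec (e : B.LocalTriv) {x : M} (hx : x ∈ e.baseSet) (a : G) :
    B.proj (e.sec x a) = x :=
  e.toTrivialization.proj_symm_apply' hx

theorem LocalTriv.fib_sec (e : B.LocalTriv) {x : M} (hx : x ∈ e.baseSet) (a : G) :
    e.fib (e.sec x a) = a :=
  congrArg Prod.snd (e.toTrivialization.apply_symm_apply' hx)

theorem LocalTriv.sec_fib (e : B.LocalTriv) {p : P} (hp : B.proj p ∈ e.baseSet) :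
    e.sec (B.proj p) (e.fib p) = p :=
  e.toTrivialization.symm_apply_mk_proj (e.toTrivialization.mem_source.2 hp)

theorem LocalTriv.sec_mul (e : B.LocalTriv) {x : M} (hx : x ∈ e.baseSet) (a g : G) :
    e.sec x (a * g) = B.act (e.sec x a) g := by
  have h1 : B.proj (B.act (e.sec x a) g) = x := by rw [B.proj_act, e.proj_sec hx]
  have h2 := e.sec_fib (p := B.act (e.sec x a) g) (by rwa [h1])
  rwa [h1, e.fib_act (by rwa [e.proj_sec hx]), e.fib_sec hx] at h2

theorem LocalTriv.contMDiffOn_sec (e : B.LocalTriv) :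
    ContMDiffOn (IM.prod IG) IP ∞ (fun z : M × G => e.sec z.1 z.2) (e.baseSet ×ˢ univ) := by
  have := e.contMDiffOn_symm
  rwa [e.target_eq] at this

theorem LocalTriv.contMDiffOn_fib (e : B.LocalTriv) :
    ContMDiffOn IP IG ∞ e.fib (B.proj ⁻¹' e.baseSet) := by
  have := e.contMDiffOn_toFun
  rw [e.source_eq] at this
  exact contMDiff_snd.comp_contMDiffOn this

variable (B) in
theorem exists_localTriv (x : M) : ∃ e : B.LocalTriv, x ∈ e.baseSet := by
  obtain ⟨e, hx, h1, h2, h3⟩ := B.exists_trivialization x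
  exact ⟨⟨e, h1, h2, h3⟩, hx⟩

/-- `\overline{(p, q)} ↦ ((π p, π q), e(p) f(q)⁻¹)`, see `chartFun_toGauge`. -/
def chartFun (e f : B.LocalTriv) (z : B.GaugeSpace) : (M × M) × G :=
  ((B.tgt z, B.src z), e.fib (Quotient.out z).1 * (f.fib (Quotient.out z).2)⁻¹)

theorem chartFun_toGauge (e f : B.LocalTriv) (p q : P) (hp : B.proj p ∈ e.baseSet)
    (hq : B.proj q ∈ f.baseSet) :
    chartFun e f (B.toGauge (p, q)) = ((B.proj p, B.proj q), e.fib p * (f.fib q)⁻¹) := by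
  have h : B.toGauge (p, q) = B.toGauge (Quotient.out (B.toGauge (p, q))) := (Quotient.out_eq _).symm
  obtain ⟨g, hg⟩ := B.toGauge_eq_iff.1 h
  simp only [chartFun, B.tgt_toGauge, B.src_toGauge, hg, e.fib_act hp, f.fib_act hq]
  simp

variable (B) in
/-- A local trivialization of `P` around `x`. -/
def trivAt (x : M) : B.LocalTriv := (B.exists_localTriv x).choose

theorem mem_baseSet_trivAt (x : M) : x ∈ (B.trivAt x).baseSet :=
  (B.exists_localTriv x).choose_spec

variable [LieGroup IG ∞ G]

/-- The local trivialization of `(tgt, src) : 𝒢(P) → M × M` with fibre `G` induced by local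
trivializations `e`, `f` of `P`; its inverse is `((x, y), a) ↦ \overline{(e⁻¹(x, a), f⁻¹(y, 1))}`. -/
def gaugeTriv (e f : B.LocalTriv) : OpenPartialHomeomorph B.GaugeSpace ((M × M) × G) where
  toFun := chartFun e f
  invFun w := B.toGauge (e.sec w.1.1 w.2, f.sec w.1.2 1)
  source := {z | B.tgt z ∈ e.baseSet ∧ B.src z ∈ f.baseSet}
  target := (e.baseSet ×ˢ f.baseSet) ×ˢ univ
  map_source' := by
    intro z hz
    exact ⟨hz, mem_univ _⟩
  map_target' := by
    rintro ⟨⟨x, y⟩, a⟩ ⟨⟨hx, hy⟩, -⟩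
    simp only [mem_ofPred_eq, tgt_toGauge, src_toGauge]
    exact ⟨by rwa [e.proj_sec hx], by rwa [f.proj_sec hy]⟩
  left_inv' := by
    intro z hz
    obtain ⟨⟨p, q⟩, rfl⟩ := B.toGauge_surjective z
    obtain ⟨hp, hq⟩ := hz
    rw [chartFun_toGauge e f p q hp hq]
    rw [← B.toGauge_act _ _ (f.fib q)]
    simp only [B.tgt_toGauge, B.src_toGauge] at hp hq
    rw [← e.sec_mul hp, ← f.sec_mul hq, inv_mul_cancel_right, one_mul, e.sec_fib hp, f.sec_fib hq]
  right_inv' := by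
    rintro ⟨⟨x, y⟩, a⟩ ⟨⟨hx, hy⟩, -⟩
    simp only at hx hy ⊢
    rw [chartFun_toGauge e f _ _ (by rwa [e.proj_sec hx]) (by rwa [f.proj_sec hy])]
    simp [e.proj_sec hx, f.proj_sec hy, e.fib_sec hx, f.fib_sec hy]
  open_source := (e.open_baseSet.preimage B.continuous_tgt).inter
    (f.open_baseSet.preimage B.continuous_src)
  open_target := (e.open_baseSet.prod f.open_baseSet).prod isOpen_univ
  continuousOn_toFun := by
    intro z hz
    obtain ⟨⟨p, q⟩, rfl⟩ := B.toGauge_surjective z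
    refine ContinuousAt.continuousWithinAt ?_
    rw [← B.isOpenQuotientMap_toGauge.continuousAt_comp_iff]
    obtain ⟨hp, hq⟩ := hz
    simp only [B.tgt_toGauge, B.src_toGauge] at hp hq
    have hπ := B.contMDiff_proj.continuous
    have hep : {p | B.proj p ∈ e.baseSet} ∈ 𝓝 p := (e.open_baseSet.preimage hπ).mem_nhds hp
    have hfq : {q | B.proj q ∈ f.baseSet} ∈ 𝓝 q := (f.open_baseSet.preimage hπ).mem_nhds hq
    have : (fun z : P × P => ((B.proj z.1, B.proj z.2), e.fib z.1 * (f.fib z.2)⁻¹))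
        =ᶠ[𝓝 (p, q)] chartFun e f ∘ B.toGauge := by
      filter_upwards [prod_mem_nhds hep hfq] with z hz
      exact (chartFun_toGauge e f z.1 z.2 hz.1 hz.2).symm
    refine ContinuousAt.congr ?_ this
    have : IsTopologicalGroup G := topologicalGroup_of_lieGroup IG ∞
    have h1 : ContinuousAt e.fib p := e.contMDiffOn_fib.continuousOn.continuousAt hep
    have h2 : ContinuousAt f.fib q := f.contMDiffOn_fib.continuousOn.continuousAt hfq
    exact ((hπ.comp continuous_fst).prodMk (hπ.comp continuous_snd)).continuousAt.prodMk
      ((h1.comp (x := (p, q)) continuousAt_fst).mul (h2.comp (x := (p, q)) continuousAt_snd).inv)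
  continuousOn_invFun := by
    refine B.continuous_toGauge.comp_continuousOn (ContinuousOn.prodMk ?_ ?_)
    · exact e.contMDiffOn_sec.continuousOn.comp
        (f := fun w : (M × M) × G => (w.1.1, w.2)) (by fun_prop) (fun w hw => ⟨hw.1.1, mem_univ _⟩)
    · exact f.contMDiffOn_sec.continuousOn.comp
        (f := fun w : (M × M) × G => (w.1.2, (1 : G))) (by fun_prop)
        (fun w hw => ⟨hw.1.2, mem_univ _⟩)

/-- `𝒢(P)` is locally homeomorphic to `M × M × G`, through the maps `gaugeTriv e f`. -/
instance : ChartedSpace ((M × M) × G) B.GaugeSpace where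
  atlas := {c | ∃ e f : B.LocalTriv, c = gaugeTriv e f}
  chartAt z := gaugeTriv (B.trivAt (B.tgt z)) (B.trivAt (B.src z))
  mem_chart_source _ := ⟨mem_baseSet_trivAt _, mem_baseSet_trivAt _⟩
  chart_mem_atlas _ := ⟨_, _, rfl⟩

/-- The manifold structure of `𝒢(P)`: the charts are the maps `gaugeTriv e f` followed by charts of
`M × M × G`. -/
instance : ChartedSpace (ModelProd (ModelProd HM HM) HG) B.GaugeSpace :=
  ChartedSpace.comp _ ((M × M) × G) _

theorem contMDiffOn_gaugeTriv_symm_trans (e f e' f' : B.LocalTriv) :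
    ContMDiffOn ((IM.prod IM).prod IG) ((IM.prod IM).prod IG) ∞
      ((gaugeTriv e f).symm ≫ₕ gaugeTriv e' f') ((gaugeTriv e f).symm ≫ₕ gaugeTriv e' f').source := by
  set S := ((gaugeTriv e f).symm ≫ₕ gaugeTriv e' f').source with hS
  have key : ∀ w ∈ S, w.1.1 ∈ e.baseSet ∧ w.1.2 ∈ f.baseSet ∧ w.1.1 ∈ e'.baseSet ∧
      w.1.2 ∈ f'.baseSet := by
    intro w hw
    rw [hS, OpenPartialHomeomorph.trans_source] at hw
    obtain ⟨⟨⟨hx, hy⟩, -⟩, h2⟩ := hw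
    have h2' : B.proj (e.sec w.1.1 w.2) ∈ e'.baseSet ∧ B.proj (f.sec w.1.2 1) ∈ f'.baseSet := h2
    rw [e.proj_sec hx, f.proj_sec hy] at h2'
    exact ⟨hx, hy, h2'⟩
  have hcongr : ∀ w ∈ S, ((gaugeTriv e f).symm ≫ₕ gaugeTriv e' f') w =
      (w.1, e'.fib (e.sec w.1.1 w.2) * (f'.fib (f.sec w.1.2 1))⁻¹) := by
    intro w hw
    obtain ⟨h1, h2, h3, h4⟩ := key w hw
    change chartFun e' f' (B.toGauge (e.sec w.1.1 w.2, f.sec w.1.2 1)) = _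
    rw [chartFun_toGauge e' f' _ _ (by rwa [e.proj_sec h1]) (by rwa [f.proj_sec h2]),
      e.proj_sec h1, f.proj_sec h2]
  refine ContMDiffOn.congr ?_ hcongr
  refine contMDiff_fst.contMDiffOn.prodMk (ContMDiffOn.mul ?_ (ContMDiffOn.inv ?_))
  · refine e'.contMDiffOn_fib.comp (e.contMDiffOn_sec.comp
      (f := fun w : (M × M) × G => (w.1.1, w.2)) ?_ ?_) ?_
    · exact ((contMDiff_fst.comp contMDiff_fst).prodMk contMDiff_snd).contMDiffOn
    · exact fun w hw => ⟨(key w hw).1, mem_univ _⟩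
    · intro w hw
      obtain ⟨h1, h2, h3, h4⟩ := key w hw
      change B.proj (e.sec w.1.1 w.2) ∈ e'.baseSet
      rwa [e.proj_sec h1]
  · refine f'.contMDiffOn_fib.comp (f.contMDiffOn_sec.comp
      (f := fun w : (M × M) × G => (w.1.2, (1 : G))) ?_ ?_) ?_
    · exact ((contMDiff_snd.comp contMDiff_fst).prodMk contMDiff_const).contMDiffOn
    · exact fun w hw => ⟨(key w hw).2.1, mem_univ _⟩
    · intro w hw
      obtain ⟨h1, h2, h3, h4⟩ := key w hw
      change B.proj (f.sec w.1.2 1) ∈ f'.baseSet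
      rwa [f.proj_sec h2]

instance [IsManifold IM ∞ M] : IsManifold ((IM.prod IM).prod IG) ∞ B.GaugeSpace := by
  have smooth : ∀ (e f e' f' : B.LocalTriv)
      (c c' : OpenPartialHomeomorph ((M × M) × G) (ModelProd (ModelProd HM HM) HG)),
      c ∈ atlas (ModelProd (ModelProd HM HM) HG) ((M × M) × G) →
      c' ∈ atlas (ModelProd (ModelProd HM HM) HG) ((M × M) × G) →
      ContMDiffOn ((IM.prod IM).prod IG) ((IM.prod IM).prod IG) ∞
        ((gaugeTriv e f ≫ₕ c).symm ≫ₕ (gaugeTriv e' f' ≫ₕ c'))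
        ((gaugeTriv e f ≫ₕ c).symm ≫ₕ (gaugeTriv e' f' ≫ₕ c')).source := by
    intro e f e' f' c c' hc hc'
    have h1 := contMDiffOn_of_mem_maximalAtlas (I := (IM.prod IM).prod IG) (n := ∞)
      (IsManifold.subset_maximalAtlas hc')
    have h2 := contMDiffOn_symm_of_mem_maximalAtlas (I := (IM.prod IM).prod IG) (n := ∞)
      (IsManifold.subset_maximalAtlas hc)
    have h3 := contMDiffOn_gaugeTriv_symm_trans e f e' f'
    refine (h1.comp (h3.comp (h2.mono ?_) ?_) ?_)
    · intro w hw
      simp only [mfld_simps] at hw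
      exact hw.1.1
    · intro w hw
      simp only [mfld_simps] at hw ⊢
      exact ⟨hw.1.2, hw.2.1⟩
    · intro w hw
      simp only [mfld_simps] at hw ⊢
      exact hw.2.2
  refine { compatible := ?_ }
  rintro _ _ ⟨_, ⟨e, f, rfl⟩, c, hc, rfl⟩ ⟨_, ⟨e', f', rfl⟩, c', hc', rfl⟩
  have hmem := (IsManifold.mem_maximalAtlas_iff_contMDiffOn (I := (IM.prod IM).prod IG) (n := ∞)
    ((gaugeTriv e f ≫ₕ c).symm ≫ₕ (gaugeTriv e' f' ≫ₕ c'))).2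
    ⟨smooth e f e' f' c c' hc hc', smooth e' f' e f c' c hc' hc⟩
  have := (mem_maximalAtlas_iff.1 hmem (OpenPartialHomeomorph.refl _) (by simp)).2
  simpa using this

end Smooth

/-! ### Principal connections and the vertical distribution -/

section Connection

variable (B : PrincipalBundle IM IP IG M P G)

/-- The value at `p` of the infinitesimal generator `u_P`, i.e. the derivative of `g ↦ p · g` at
`1` in the direction `u ∈ 𝔤 = T₁G`. -/
def generator (u : GroupLieAlgebra IG G) (p : P) : TangentSpace IP p :=
  (mfderiv IG IP (fun g : G => B.act p g) 1 : EG →L[ℝ] EP) u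

/-- The vertical bundle `V ⊆ TP`, with fibre `{u_P(p) | u ∈ 𝔤}` over `p`. -/
def verticalBundle : Set (TangentBundle IP P) :=
  {X | ∃ u : GroupLieAlgebra IG G, X.2 = B.generator u X.1}

variable (IG) in
/-- The adjoint action `Ad_g : 𝔤 → 𝔤`, the derivative of `h ↦ g h g⁻¹` at `1`. -/
def adjointAction (g : G) (u : GroupLieAlgebra IG G) : GroupLieAlgebra IG G :=
  (mfderiv IG IG (fun h : G => g * h * g⁻¹) 1 : EG →L[ℝ] EG) u

/-- A principal connection: a smooth `𝔤`-valued one-form `θ` on `P` with `θ(u_P) = u` and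
`ψ_g^* θ = Ad_{g⁻¹} θ`, where `ψ_g p = p · g`. -/
@[ext]
structure PrincipalConnection [IsManifold IP ∞ P] where
  toFun : ∀ p : P, TangentSpace IP p →L[ℝ] GroupLieAlgebra IG G
  contMDiff_toFun : ContMDiff (M' := EG) IP.tangent 𝓘(ℝ, EG) ∞
    (fun X : TangentBundle IP P => toFun X.1 X.2)
  map_generator : ∀ p u, toFun p (generator B u p) = u
  map_act : ∀ p g (X : TangentSpace IP p),
    toFun (act B p g) (mfderiv IP IP (fun q => act B q g) p X) = adjointAction IG g⁻¹ (toFun p X)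

variable {B} in
/-- The endomorphism `Θ(X) = (θ(X))_P` of `TP` associated with a connection `θ`. -/
def PrincipalConnection.verticalProjection [IsManifold IP ∞ P] (θ : B.PrincipalConnection)
    (X : TangentBundle IP P) : TangentBundle IP P :=
  ⟨X.1, B.generator (θ.toFun X.1 X.2) X.1⟩

variable [LieGroup IG ∞ G]

/-- The element `\overline{(X, Y)}` of `T𝒢(P)`: the image of `(X, Y) ∈ TP × TP` under the tangent
map of the quotient map `P × P → 𝒢(P)`. -/
def tangentToGauge (X Y : TangentBundle IP P) :
    TangentBundle ((IM.prod IM).prod IG) B.GaugeSpace :=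
  tangentMap (IP.prod IP) ((IM.prod IM).prod IG) B.toGauge ⟨(X.1, Y.1), (X.2, Y.2)⟩

/-- `Δ_V ⊆ T𝒢(P)`, the image of `V × V` under the quotient map `TP × TP → T𝒢(P)`. -/
def gaugeVertical : Set (TangentBundle ((IM.prod IM).prod IG) B.GaugeSpace) :=
  {W | ∃ X ∈ B.verticalBundle, ∃ Y ∈ B.verticalBundle, B.tangentToGauge X Y = W}

end Connection

end PrincipalBundle

end

/-! Everything rests on the kernel of the differential of P × P → 𝒢(P). At (p, q) it is {(u_P(p),
u_P(q)) : u ∈ 𝔤}: composing with target and source forces both components of a kernel vector to be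
vertical, and freeness of the action forces the two generators to agree (`dToGauge_eq_zero_iff`).
Hence two pairs in TP × TP have the same class iff one arises from the other by adding u_P to both
components and translating both by some g (`tangentToGauge_eq_iff`). It also follows that every
element of Δ_V over \overline{(p, q)} has a unique normal form \overline{(u_P(p), 0_q)}.

From θ to K: Θ commutes with right translations and fixes vertical vectors, so (X, Y) ↦ (ΘX, ΘY)
descends to the quotient, smoothly because the quotient map has smooth local sections.
Multiplicativity holds because composable vectors lift to pairs with a common middle leg,
\overline{(S, T)} · \overline{(T, U)} = \overline{(S, U)}; vertical vectors project to zero, so the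
base form K_M is 0.

From K to θ: the image of K is Δ_V, so the normal form over units, K \overline{(v, 0_p)} =
\overline{(u_P(p), 0_p)}, defines θ(v) = u. Idempotence gives θ(u_P) = u, and the invariance of
classes under G gives equivariance. Multiplicativity then determines K from θ: \overline{(v, 0_q)} =
\overline{(v, 0_p)} · \overline{(0_p, 0_q)} gives the left leg (`formFlat_left`), the vanishing of
\overline{(0_p, w)} · \overline{(w, 0_p)} gives the right leg (`formFlat_right`), and linearity adds
the two. -/

noncomputable section

/-! ### Derivatives between model spaces -/

section FlatDerivative

variable {E : Type*} [NormedAddCommGroup E] [NormedSpace ℝ E]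
  {H : Type*} [TopologicalSpace H] {I : ModelWithCorners ℝ E H}
  {N : Type*} [TopologicalSpace N] [ChartedSpace H N]
  {E' : Type*} [NormedAddCommGroup E'] [NormedSpace ℝ E']
  {H' : Type*} [TopologicalSpace H'] {I' : ModelWithCorners ℝ E' H'}
  {N' : Type*} [TopologicalSpace N'] [ChartedSpace H' N']
  {E'' : Type*} [NormedAddCommGroup E''] [NormedSpace ℝ E'']
  {H'' : Type*} [TopologicalSpace H''] {I'' : ModelWithCorners ℝ E'' H''}
  {N'' : Type*} [TopologicalSpace N''] [ChartedSpace H'' N'']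

variable (I I') in
/-- The derivative `mfderiv I I' f x`, as a map between the model spaces. -/
def flatDeriv (f : N → N') (x : N) : E →L[ℝ] E' := mfderiv I I' f x

/-- All tangent spaces of N unfold to the model space `E`, so `h'` makes sense without transport
along `h`. This is why differentials are handled below as maps between model spaces. -/
theorem tangentBundle_ext {X Y : TangentBundle I N} (h : X.1 = Y.1) (h' : (X.2 : E) = Y.2) :
    X = Y := by
  obtain ⟨x, v⟩ := X
  obtain ⟨y, w⟩ := Y
  obtain rfl : x = y := h
  obtain rfl : v = w := h'
  rfl

/-- The vector part of an element of the tangent bundle, in the model space. -/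
def flatVec (X : TangentBundle I N) : E := X.2

theorem flatDeriv_congr {f g : N → N'} {x : N} (h : f =ᶠ[𝓝 x] g) :
    flatDeriv I I' f x = flatDeriv I I' g x :=
  h.mfderiv_eq

theorem flatDeriv_comp {g : N' → N''} {f : N → N'} (x : N)
    (hg : MDifferentiableAt I' I'' g (f x)) (hf : MDifferentiableAt I I' f x) :
    flatDeriv I I'' (fun y => g (f y)) x =
      (flatDeriv I' I'' g (f x)).comp (flatDeriv I I' f x) :=
  mfderiv_comp x hg hf

theorem flatDeriv_comp_apply {g : N' → N''} {f : N → N'} (x : N)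
    (hg : MDifferentiableAt I' I'' g (f x)) (hf : MDifferentiableAt I I' f x) (v : E) :
    flatDeriv I I'' (fun y => g (f y)) x v =
      flatDeriv I' I'' g (f x) (flatDeriv I I' f x v) := by
  rw [flatDeriv_comp x hg hf]; rfl

theorem flatDeriv_id (x : N) : flatDeriv I I (fun y : N => y) x = ContinuousLinearMap.id ℝ E :=
  mfderiv_id

theorem flatDeriv_const (c : N') (x : N) : flatDeriv I I' (fun _ : N => c) x = 0 :=
  mfderiv_const

theorem flatDeriv_prodMk {f : N → N'} {g : N → N''} {x : N} (hf : MDifferentiableAt I I' f x)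
    (hg : MDifferentiableAt I I'' g x) :
    flatDeriv I (I'.prod I'') (fun y => (f y, g y)) x =
      (flatDeriv I I' f x).prod (flatDeriv I I'' g x) :=
  mfderiv_prodMk hf hg

theorem flatDeriv_const_prodMk (x : N) (y : N') (v : E') :
    flatDeriv I' (I.prod I') (fun z => (x, z)) y v = (0, v) := by
  rw [flatDeriv_prodMk (g := fun z => z) mdifferentiableAt_const mdifferentiableAt_id,
    flatDeriv_const, flatDeriv_id]
  rfl

theorem flatDeriv_prodMk_const (x : N) (y : N') (v : E) :
    flatDeriv I (I.prod I') (fun z => (z, y)) x v = (v, 0) := by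
  rw [flatDeriv_prodMk (f := fun z => z) mdifferentiableAt_id mdifferentiableAt_const,
    flatDeriv_const, flatDeriv_id]
  rfl

/-- The partial derivative in the second variable. -/
theorem flatDeriv_zero_prod {f : N × N' → N''} {x : N} {y : N'}
    (hf : MDifferentiableAt (I.prod I') I'' f (x, y)) (v : E') :
    flatDeriv (I.prod I') I'' f (x, y) (0, v) = flatDeriv I' I'' (fun z => f (x, z)) y v := by
  rw [flatDeriv_comp_apply (g := f) (f := fun z => (x, z)) y hf
    (mdifferentiableAt_const.prodMk mdifferentiableAt_id), flatDeriv_const_prodMk]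

/-- The partial derivative in the first variable. -/
theorem flatDeriv_prod_zero {f : N × N' → N''} {x : N} {y : N'}
    (hf : MDifferentiableAt (I.prod I') I'' f (x, y)) (v : E) :
    flatDeriv (I.prod I') I'' f (x, y) (v, 0) = flatDeriv I I'' (fun z => f (z, y)) x v := by
  rw [flatDeriv_comp_apply (g := f) (f := fun z => (z, y)) x hf
    (mdifferentiableAt_id.prodMk mdifferentiableAt_const), flatDeriv_prodMk_const]

/-- The tangent vectors `X` and `Y` together, as a tangent vector of the product. -/
def tangentPair (X : TangentBundle I N) (Y : TangentBundle I' N') :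
    TangentBundle (I.prod I') (N × N') :=
  ⟨(X.1, Y.1), ((X.2 : E), (Y.2 : E'))⟩

theorem ContMDiffAt.tangentPair [IsManifold I ∞ N] [IsManifold I' ∞ N']
    {f : N'' → TangentBundle I N} {g : N'' → TangentBundle I' N'} {x : N''}
    (hf : ContMDiffAt I'' I.tangent ∞ f x) (hg : ContMDiffAt I'' I'.tangent ∞ g x) :
    ContMDiffAt I'' (I.prod I').tangent ∞ (fun y => tangentPair (f y) (g y)) x := by
  have : IsManifold I 1 N := .of_le (n := ∞) (by simp)
  have : IsManifold I' 1 N' := .of_le (n := ∞) (by simp)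
  exact (contMDiff_equivTangentBundleProd_symm (n := ∞) (I := I) (I' := I') (M := N) (M' := N')
    ).contMDiffAt.comp x (hf.prodMk hg)

theorem ContMDiffOn.contMDiffOn_tangentMap_of_isOpen [IsManifold I ∞ N] [IsManifold I' ∞ N']
    {f : N → N'} {s : Set N} (hs : IsOpen s) (hf : ContMDiffOn I I' ∞ f s) :
    ContMDiffOn I.tangent I'.tangent ∞ (tangentMap I I' f) (TotalSpace.proj ⁻¹' s) := by
  have : IsManifold I 1 N := .of_le (n := ∞) (by simp)
  have : IsManifold I' 1 N' := .of_le (n := ∞) (by simp)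
  refine (hf.contMDiffOn_tangentMapWithin (m := ∞) (by simp) hs.uniqueMDiffOn).congr ?_
  intro X hX
  simp only [tangentMap, tangentMapWithin]
  rw [mfderivWithin_of_isOpen hs hX]

/-- A family of tangent vectors at a fixed point is smooth in the tangent bundle iff it is smooth as
a family of vectors. -/
theorem contMDiffAt_tangentSpace_iff [IsManifold I ∞ N] {a : N} {f : N'' → E} {x : N''} :
    ContMDiffAt I'' I.tangent ∞ (fun y => (⟨a, f y⟩ : TangentBundle I N)) x ↔
      ContMDiffAt I'' 𝓘(ℝ, E) ∞ f x := by
  have : IsManifold I 1 N := .of_le (n := ∞) (by simp)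
  rw [contMDiffAt_totalSpace]
  have : (fun y => (trivializationAt E (TangentSpace I) a (⟨a, f y⟩ : TangentBundle I N)).2) = f := by
    ext y
    exact tangentCoordChange_self (mem_extChartAt_source (I := I) a)
  simp only [this, contMDiffAt_const, true_and]

theorem velocity_congr {γ δ : ℝ → N} (h : γ =ᶠ[𝓝 0] δ) : velocity I γ = velocity I δ :=
  tangentBundle_ext h.eq_of_nhds (by
    change flatDeriv 𝓘(ℝ, ℝ) I γ 0 1 = flatDeriv 𝓘(ℝ, ℝ) I δ 0 1
    rw [flatDeriv_congr h])

variable [IsManifold I ∞ N]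

/-- On a manifold without boundary every tangent vector is the velocity of a smooth curve which is
defined for all times. -/
theorem exists_contMDiff_velocity_eq [I.Boundaryless] (X : TangentBundle I N) :
    ∃ γ : ℝ → N, ContMDiff 𝓘(ℝ, ℝ) I ∞ γ ∧ velocity I γ = X := by
  obtain ⟨x, v⟩ := X
  change E at v
  set φ := extChartAt I x
  obtain ⟨ε, hε, hball⟩ := Metric.isOpen_iff.1 (isOpen_extChartAt_target (I := I) x) (φ x)
    (mem_extChartAt_target x)
  -- A straight line in the chart would leave its target. The curve φ x + c sin(t/c) v has velocity
  -- v at 0 and stays within c‖v‖ < ε of φ x for all t.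
  set c : ℝ := ε / (‖v‖ + 1) with hc
  have hv : 0 < ‖v‖ + 1 := by positivity
  have hc0 : 0 < c := by positivity
  let σ : ℝ → E := fun t => φ x + (c * Real.sin (t / c)) • v
  have hσ : ContDiff ℝ ∞ σ := by
    refine contDiff_const.add (ContDiff.smul ?_ contDiff_const)
    exact contDiff_const.mul (Real.contDiff_sin.comp (contDiff_id.div_const c))
  have hσ0 : σ 0 = φ x := by simp [σ]
  have hmem : ∀ t, σ t ∈ φ.target := by
    intro t
    refine hball ?_
    rw [Metric.mem_ball, dist_eq_norm]
    simp only [σ, add_sub_cancel_left, norm_smul, norm_mul, Real.norm_eq_abs, abs_of_pos hc0]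
    calc c * |Real.sin (t / c)| * ‖v‖ ≤ c * 1 * ‖v‖ := by
          gcongr; exact Real.abs_sin_le_one _
      _ < c * (‖v‖ + 1) := by nlinarith
      _ = ε := by rw [hc]; field_simp
  have hderiv : HasDerivAt σ v 0 := by
    have h1 : HasDerivAt (fun t : ℝ => t / c) (1 / c) 0 := (hasDerivAt_id 0).div_const c
    have h2 := ((h1.sin.const_mul c).smul_const v).const_add (φ x)
    convert h2 using 1
    simp [hc0.ne']
  have hsymm : ContMDiffOn 𝓘(ℝ, E) I ∞ φ.symm φ.target := contMDiffOn_extChartAt_symm x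
  have hsm : ContMDiff 𝓘(ℝ, ℝ) I ∞ (fun t => φ.symm (σ t)) := fun t =>
    (hsymm.contMDiffAt ((isOpen_extChartAt_target x).mem_nhds (hmem t))).comp t
      hσ.contMDiff.contMDiffAt
  refine ⟨_, hsm, ?_⟩
  refine tangentBundle_ext ?_ ?_
  · change φ.symm (σ 0) = x
    rw [hσ0]; exact extChartAt_to_inv x
  · change flatDeriv 𝓘(ℝ, ℝ) I (fun t => φ.symm (σ t)) 0 1 = v
    rw [flatDeriv_comp_apply (I' := 𝓘(ℝ, E)) 0
      ((hsymm.contMDiffAt ((isOpen_extChartAt_target x).mem_nhds (hmem 0))).mdifferentiableAt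
        (by simp)) (hσ.contMDiff.contMDiffAt.mdifferentiableAt (by simp))]
    have h1 : flatDeriv 𝓘(ℝ, ℝ) 𝓘(ℝ, E) σ 0 1 = v := by
      change mfderiv 𝓘(ℝ, ℝ) 𝓘(ℝ, E) σ 0 1 = v
      rw [mfderiv_eq_fderiv]
      exact hderiv.deriv
    have : IsManifold I 1 N := .of_le (n := ∞) (by simp)
    -- The preferred chart at x is the one identifying T_xN with `E`, so its inverse has derivative
    -- the identity there.
    have h2 : flatDeriv 𝓘(ℝ, E) I φ.symm (φ x) = ContinuousLinearMap.id ℝ E := by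
      have := mfderivWithin_range_extChartAt_symm (I := I) (x := x)
      rw [ModelWithCorners.range_eq_univ, mfderivWithin_univ] at this
      exact this
    rw [h1, hσ0, h2]; rfl

end FlatDerivative

namespace PrincipalBundle

variable {EM : Type*} [NormedAddCommGroup EM] [NormedSpace ℝ EM]
  {HM : Type*} [TopologicalSpace HM] {IM : ModelWithCorners ℝ EM HM}
  {EP : Type*} [NormedAddCommGroup EP] [NormedSpace ℝ EP]
  {HP : Type*} [TopologicalSpace HP] {IP : ModelWithCorners ℝ EP HP}
  {EG : Type*} [NormedAddCommGroup EG] [NormedSpace ℝ EG]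
  {HG : Type*} [TopologicalSpace HG] {IG : ModelWithCorners ℝ EG HG}
  {M : Type*} [TopologicalSpace M] [ChartedSpace HM M]
  {P : Type*} [TopologicalSpace P] [ChartedSpace HP P]
  {G : Type*} [TopologicalSpace G] [ChartedSpace HG G] [Group G]
  (B : PrincipalBundle IM IP IG M P G)

/-! ### Smoothness of the charts, the quotient map and its local sections -/

section Charts

variable {B}

theorem LocalTriv.mdifferentiableAt_fib (e : B.LocalTriv) {p : P} (hp : B.proj p ∈ e.baseSet) :
    MDifferentiableAt IP IG e.fib p :=
  (e.contMDiffOn_fib.contMDiffAt ((e.open_baseSet.preimage B.contMDiff_proj.continuous).mem_nhds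
    hp)).mdifferentiableAt (by simp)

theorem LocalTriv.contMDiffAt_sec (e : B.LocalTriv) {x : M} (hx : x ∈ e.baseSet) (a : G) :
    ContMDiffAt (IM.prod IG) IP ∞ (fun z : M × G => e.sec z.1 z.2) (x, a) :=
  e.contMDiffOn_sec.contMDiffAt ((e.open_baseSet.prod isOpen_univ).mem_nhds ⟨hx, mem_univ _⟩)

variable [LieGroup IG ∞ G] [IsManifold IM ∞ M]

/-- The charts of 𝒢(P) are the composites `gaugeTriv e f ≫ₕ c`. Following such a chart by the
inverse of c, itself smooth, gives back `gaugeTriv e f`. -/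
theorem contMDiffOn_gaugeTriv (e f : B.LocalTriv) :
    ContMDiffOn ((IM.prod IM).prod IG) ((IM.prod IM).prod IG) ∞ (gaugeTriv e f)
      (gaugeTriv e f).source := by
  have : IsManifold IG ∞ G := ContMDiffMul.toIsManifold
  intro z hz
  set c := chartAt (ModelProd (ModelProd HM HM) HG) (gaugeTriv e f z) with hc
  have hmem : gaugeTriv e f ≫ₕ c ∈ atlas (ModelProd (ModelProd HM HM) HG) B.GaugeSpace :=
    ⟨_, ⟨e, f, rfl⟩, c, chart_mem_atlas _ _, rfl⟩
  have h1 : ContMDiffOn ((IM.prod IM).prod IG) ((IM.prod IM).prod IG) ∞ (gaugeTriv e f ≫ₕ c)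
      (gaugeTriv e f ≫ₕ c).source :=
    contMDiffOn_of_mem_maximalAtlas (IsManifold.subset_maximalAtlas hmem)
  have h2 : ContMDiffOn ((IM.prod IM).prod IG) ((IM.prod IM).prod IG) ∞ c.symm c.target :=
    contMDiffOn_symm_of_mem_maximalAtlas (IsManifold.chart_mem_maximalAtlas _)
  have hzc : gaugeTriv e f z ∈ c.source := mem_chart_source _ _
  have hz' : z ∈ (gaugeTriv e f ≫ₕ c).source := by
    rw [OpenPartialHomeomorph.trans_source]; exact ⟨hz, hzc⟩
  have h3 := (h2.contMDiffAt (c.open_target.mem_nhds (c.map_source hzc))).comp z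
    (h1.contMDiffAt ((gaugeTriv e f ≫ₕ c).open_source.mem_nhds hz'))
  refine (h3.congr_of_eventuallyEq ?_).contMDiffWithinAt
  filter_upwards [(gaugeTriv e f ≫ₕ c).open_source.mem_nhds hz'] with w hw
  rw [OpenPartialHomeomorph.trans_source] at hw
  exact (c.left_inv hw.2).symm

theorem contMDiffOn_gaugeTriv_symm (e f : B.LocalTriv) :
    ContMDiffOn ((IM.prod IM).prod IG) ((IM.prod IM).prod IG) ∞ (gaugeTriv e f).symm
      (gaugeTriv e f).target := by
  have : IsManifold IG ∞ G := ContMDiffMul.toIsManifold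
  intro z hz
  set c := chartAt (ModelProd (ModelProd HM HM) HG) z with hc
  have hmem : gaugeTriv e f ≫ₕ c ∈ atlas (ModelProd (ModelProd HM HM) HG) B.GaugeSpace :=
    ⟨_, ⟨e, f, rfl⟩, c, chart_mem_atlas _ _, rfl⟩
  have h1 : ContMDiffOn ((IM.prod IM).prod IG) ((IM.prod IM).prod IG) ∞ (gaugeTriv e f ≫ₕ c).symm
      (gaugeTriv e f ≫ₕ c).target :=
    contMDiffOn_symm_of_mem_maximalAtlas (IsManifold.subset_maximalAtlas hmem)
  have h2 : ContMDiffOn ((IM.prod IM).prod IG) ((IM.prod IM).prod IG) ∞ c c.source :=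
    contMDiffOn_of_mem_maximalAtlas (IsManifold.chart_mem_maximalAtlas _)
  have hzc : z ∈ c.source := mem_chart_source _ _
  have hz' : c z ∈ (gaugeTriv e f ≫ₕ c).target := by
    rw [OpenPartialHomeomorph.trans_target]
    refine ⟨c.map_source hzc, ?_⟩
    rw [mem_preimage, c.left_inv hzc]
    exact hz
  have h3 := (h1.contMDiffAt ((gaugeTriv e f ≫ₕ c).open_target.mem_nhds hz')).comp z
    (h2.contMDiffAt (c.open_source.mem_nhds hzc))
  refine (h3.congr_of_eventuallyEq ?_).contMDiffWithinAt
  filter_upwards [c.open_source.mem_nhds hzc] with w hw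
  change _ = (gaugeTriv e f).symm (c.symm (c w))
  rw [c.left_inv hw]

theorem contMDiffAt_chartFun (e f : B.LocalTriv) {z : B.GaugeSpace} (ht : B.tgt z ∈ e.baseSet)
    (hs : B.src z ∈ f.baseSet) :
    ContMDiffAt ((IM.prod IM).prod IG) ((IM.prod IM).prod IG) ∞ (chartFun e f) z :=
  (contMDiffOn_gaugeTriv e f).contMDiffAt ((gaugeTriv e f).open_source.mem_nhds ⟨ht, hs⟩)

variable (B) in
theorem contMDiff_tgt : ContMDiff ((IM.prod IM).prod IG) IM ∞ B.tgt := fun z =>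
  (contMDiff_fst.comp contMDiff_fst).contMDiffAt.comp z
    (contMDiffAt_chartFun (B.trivAt (B.tgt z)) (B.trivAt (B.src z)) (mem_baseSet_trivAt _)
      (mem_baseSet_trivAt _))

variable (B) in
theorem contMDiff_src : ContMDiff ((IM.prod IM).prod IG) IM ∞ B.src := fun z =>
  (contMDiff_snd.comp contMDiff_fst).contMDiffAt.comp z
    (contMDiffAt_chartFun (B.trivAt (B.tgt z)) (B.trivAt (B.src z)) (mem_baseSet_trivAt _)
      (mem_baseSet_trivAt _))

variable (B) in
theorem contMDiff_toGauge : ContMDiff (IP.prod IP) ((IM.prod IM).prod IG) ∞ B.toGauge := by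
  rintro ⟨p, q⟩
  set e := B.trivAt (B.proj p)
  set f := B.trivAt (B.proj q)
  have hp : B.proj p ∈ e.baseSet := mem_baseSet_trivAt _
  have hq : B.proj q ∈ f.baseSet := mem_baseSet_trivAt _
  have hπ := B.contMDiff_proj.continuous
  have hep : {p | B.proj p ∈ e.baseSet} ∈ 𝓝 p := (e.open_baseSet.preimage hπ).mem_nhds hp
  have hfq : {q | B.proj q ∈ f.baseSet} ∈ 𝓝 q := (f.open_baseSet.preimage hπ).mem_nhds hq
  have h1 : ContMDiffAt (IP.prod IP) IG ∞ (fun w : P × P => e.fib w.1) (p, q) :=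
    ContMDiffAt.comp (p, q) (g := e.fib) (f := fun w : P × P => w.1)
      (e.contMDiffOn_fib.contMDiffAt hep) contMDiffAt_fst
  have h2 : ContMDiffAt (IP.prod IP) IG ∞ (fun w : P × P => f.fib w.2) (p, q) :=
    ContMDiffAt.comp (p, q) (g := f.fib) (f := fun w : P × P => w.2)
      (f.contMDiffOn_fib.contMDiffAt hfq) contMDiffAt_snd
  have h3 : ContMDiffAt (IP.prod IP) ((IM.prod IM).prod IG) ∞
      (fun w : P × P => ((B.proj w.1, B.proj w.2), e.fib w.1 * (f.fib w.2)⁻¹)) (p, q) :=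
    ((B.contMDiff_proj.comp contMDiff_fst).prodMk
      (B.contMDiff_proj.comp contMDiff_snd)).contMDiffAt.prodMk (h1.mul h2.inv)
  -- Near (p, q) the quotient map is the inverse trivialization after the explicit formula of
  -- `chartFun_toGauge`.
  have h4 := ((contMDiffOn_gaugeTriv_symm e f).contMDiffAt
    ((gaugeTriv e f).open_target.mem_nhds
      (x := ((B.proj p, B.proj q), e.fib p * (f.fib q)⁻¹)) ⟨⟨hp, hq⟩, mem_univ _⟩)).comp (p, q) h3
  refine h4.congr_of_eventuallyEq ?_
  filter_upwards [prod_mem_nhds hep hfq] with w hw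
  have := (gaugeTriv e f).left_inv (x := B.toGauge w) ⟨hw.1, hw.2⟩
  rw [← this]
  change (gaugeTriv e f).symm (chartFun e f (B.toGauge (w.1, w.2))) = _
  rw [chartFun_toGauge e f w.1 w.2 hw.1 hw.2]
  rfl

/-- The section of the quotient map `P × P → 𝒢(P)` given by two local trivializations. -/
def gaugeSection (e f : B.LocalTriv) (z : B.GaugeSpace) : P × P :=
  (e.sec (B.tgt z) (chartFun e f z).2, f.sec (B.src z) 1)

omit [IsManifold IM ∞ M] in
theorem toGauge_gaugeSection (e f : B.LocalTriv) {z : B.GaugeSpace} (ht : B.tgt z ∈ e.baseSet)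
    (hs : B.src z ∈ f.baseSet) : B.toGauge (gaugeSection e f z) = z :=
  (gaugeTriv e f).left_inv (x := z) ⟨ht, hs⟩

theorem contMDiffAt_gaugeSection (e f : B.LocalTriv) {z : B.GaugeSpace} (ht : B.tgt z ∈ e.baseSet)
    (hs : B.src z ∈ f.baseSet) :
    ContMDiffAt ((IM.prod IM).prod IG) (IP.prod IP) ∞ (gaugeSection e f) z := by
  have hc := contMDiffAt_chartFun e f ht hs
  have h1 : ContMDiffAt ((IM.prod IM).prod IG) (IM.prod IG) ∞
      (fun z : B.GaugeSpace => (B.tgt z, (chartFun e f z).2)) z :=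
    B.contMDiff_tgt.contMDiffAt.prodMk (contMDiffAt_snd.comp z hc)
  have h2 : ContMDiffAt ((IM.prod IM).prod IG) (IM.prod IG) ∞
      (fun z : B.GaugeSpace => (B.src z, (1 : G))) z :=
    B.contMDiff_src.contMDiffAt.prodMk contMDiffAt_const
  exact ((e.contMDiffAt_sec ht _).comp z h1).prodMk ((f.contMDiffAt_sec hs 1).comp z h2)

/-- For arrows `z` from the fibre of `q` to the fibre of `p`, the element `g` of `G` such that
`z = \overline{(p · g, q)}`. -/
def arrowCoord (e f : B.LocalTriv) (w : (P × P) × B.GaugeSpace) : G :=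
  (e.fib w.1.1)⁻¹ * (chartFun e f w.2).2 * f.fib w.1.2

-- Thus `arrowCoord` is a left inverse of g ↦ \overline{(p · g, q)}; its derivative will recover u
-- from \overline{(u_P(p), 0_q)}.
omit [LieGroup IG ∞ G] [IsManifold IM ∞ M] in
theorem arrowCoord_toGauge_act (e f : B.LocalTriv) {p q : P} (hp : B.proj p ∈ e.baseSet)
    (hq : B.proj q ∈ f.baseSet) (g : G) :
    arrowCoord e f ((p, q), B.toGauge (B.act p g, q)) = g := by
  rw [arrowCoord, chartFun_toGauge e f _ _ (by rwa [B.proj_act]) hq, e.fib_act hp]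
  simp [mul_assoc]

theorem contMDiffAt_arrowCoord (e f : B.LocalTriv) {p q : P} {z : B.GaugeSpace}
    (hp : B.proj p ∈ e.baseSet) (hq : B.proj q ∈ f.baseSet) (ht : B.tgt z ∈ e.baseSet)
    (hs : B.src z ∈ f.baseSet) :
    ContMDiffAt ((IP.prod IP).prod ((IM.prod IM).prod IG)) IG ∞ (arrowCoord e f) ((p, q), z) := by
  have hπ := B.contMDiff_proj.continuous
  have h1 : ContMDiffAt IP IG ∞ e.fib p :=
    e.contMDiffOn_fib.contMDiffAt ((e.open_baseSet.preimage hπ).mem_nhds hp)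
  have h2 : ContMDiffAt IP IG ∞ f.fib q :=
    f.contMDiffOn_fib.contMDiffAt ((f.open_baseSet.preimage hπ).mem_nhds hq)
  have h3 := contMDiffAt_chartFun e f ht hs
  have k1 : ContMDiffAt ((IP.prod IP).prod ((IM.prod IM).prod IG)) IG ∞
      (fun w : (P × P) × B.GaugeSpace => e.fib w.1.1) ((p, q), z) :=
    ContMDiffAt.comp ((p, q), z) (g := e.fib) (f := fun w : (P × P) × B.GaugeSpace => w.1.1)
      (I' := IP) h1 (contMDiff_fst.comp contMDiff_fst).contMDiffAt
  have k2 : ContMDiffAt ((IP.prod IP).prod ((IM.prod IM).prod IG)) IG ∞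
      (fun w : (P × P) × B.GaugeSpace => f.fib w.1.2) ((p, q), z) :=
    ContMDiffAt.comp ((p, q), z) (g := f.fib) (f := fun w : (P × P) × B.GaugeSpace => w.1.2)
      (I' := IP) h2 (contMDiff_snd.comp contMDiff_fst).contMDiffAt
  have k3 : ContMDiffAt ((IP.prod IP).prod ((IM.prod IM).prod IG)) IG ∞
      (fun w : (P × P) × B.GaugeSpace => (chartFun e f w.2).2) ((p, q), z) :=
    contMDiffAt_snd.comp ((p, q), z) (ContMDiffAt.comp ((p, q), z) (g := chartFun e f)
      (f := fun w : (P × P) × B.GaugeSpace => w.2) h3 contMDiffAt_snd)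
  exact (k1.inv.mul k3).mul k2

end Charts

/-! ### Vertical vectors -/

section Vertical

theorem contMDiff_act_left (p : P) : ContMDiff IG IP ∞ (fun g => B.act p g) :=
  B.contMDiff_act.comp (contMDiff_const.prodMk contMDiff_id)

theorem contMDiff_act_right (g : G) : ContMDiff IP IP ∞ (fun p => B.act p g) :=
  B.contMDiff_act.comp (contMDiff_id.prodMk contMDiff_const)

theorem mdifferentiableAt_act_left (p : P) (g : G) :
    MDifferentiableAt IG IP (fun g => B.act p g) g :=
  (B.contMDiff_act_left p).mdifferentiableAt (by simp)

theorem mdifferentiableAt_act_right (p : P) (g : G) :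
    MDifferentiableAt IP IP (fun p => B.act p g) p :=
  (B.contMDiff_act_right g).mdifferentiableAt (by simp)

theorem mdifferentiableAt_proj (p : P) : MDifferentiableAt IP IM B.proj p :=
  B.contMDiff_proj.mdifferentiableAt (by simp)

/-- The linear map `u ↦ u_P(p)` between the model spaces. -/
def gen (p : P) : EG →L[ℝ] EP := flatDeriv IG IP (fun g => B.act p g) 1

/-- The derivative at `p` of the right translation `q ↦ q · g`. -/
def transl (g : G) (p : P) : EP →L[ℝ] EP := flatDeriv IP IP (fun q => B.act q g) p

/-- The curve of projections g ↦ π(p · g) is constant. -/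
theorem flatDeriv_proj_gen (p : P) (u : EG) : flatDeriv IP IM B.proj p (B.gen p u) = 0 := by
  have h := flatDeriv_comp_apply (I := IG) (I' := IP) (I'' := IM) (g := B.proj)
    (f := fun g => B.act p g) 1 (B.mdifferentiableAt_proj _) (B.mdifferentiableAt_act_left p 1) u
  simp only [B.proj_act, B.act_one, flatDeriv_const] at h
  exact h.symm

theorem transl_transl (g h : G) (p : P) (v : EP) :
    B.transl h (B.act p g) (B.transl g p v) = B.transl (g * h) p v := by
  have := flatDeriv_comp_apply (I := IP) (I' := IP) (I'' := IP) (g := fun q => B.act q h)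
    (f := fun q => B.act q g) p (B.mdifferentiableAt_act_right _ _)
    (B.mdifferentiableAt_act_right _ _) v
  simp only [← B.act_mul] at this
  exact this.symm

theorem transl_one (p : P) (v : EP) : B.transl 1 p v = v := by
  rw [transl]
  simp only [B.act_one, flatDeriv_id]
  rfl

theorem transl_injective (g : G) (p : P) : Function.Injective (B.transl g p) := by
  intro v w h
  have := congrArg (B.transl g⁻¹ (B.act p g)) h
  simpa only [transl_transl, mul_inv_cancel, transl_one] using this

theorem transl_surjective (g : G) (p : P) : Function.Surjective (B.transl g p) := by
  intro v
  refine ⟨B.transl g⁻¹ (B.act p g) v, ?_⟩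
  have := B.transl_transl g⁻¹ g (B.act p g) v
  simpa only [← B.act_mul, mul_inv_cancel, B.act_one, inv_mul_cancel, transl_one] using this

/-- A vector killed by the differential of the projection is vertical. -/
theorem exists_gen_eq {p : P} {v : EP} (hv : flatDeriv IP IM B.proj p v = 0) [LieGroup IG ∞ G] :
    ∃ u, v = B.gen p u := by
  obtain ⟨e, hp⟩ := B.exists_localTriv (B.proj p)
  -- Near p one has q = e⁻¹(π q, e(p)) · k(q) with k(p) = 1, so the identity of P factors as h ∘ (π,
  -- k). If dπ v = 0, only the derivative of h in its second variable survives, and at (π p, 1) that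
  -- is u ↦ u_P(p).
  let k : P → G := fun q => (e.fib p)⁻¹ * e.fib q
  have hk : MDifferentiableAt IP IG k p :=
    ((contMDiff_mul_left (I := IG) (n := ∞) (a := (e.fib p)⁻¹)).mdifferentiableAt (by simp)).comp p
      (e.mdifferentiableAt_fib hp)
  have hkp : k p = 1 := inv_mul_cancel _
  let h : M × G → P := fun w => B.act (e.sec w.1 (e.fib p)) w.2
  have hh : MDifferentiableAt (IM.prod IG) IP h (B.proj p, 1) := by
    have h1 : ContMDiffAt (IM.prod IG) IP ∞ (fun w : M × G => e.sec w.1 (e.fib p))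
        (B.proj p, 1) :=
      ContMDiffAt.comp (B.proj p, (1 : G)) (g := fun z : M × G => e.sec z.1 z.2)
        (f := fun w : M × G => (w.1, e.fib p)) (e.contMDiffAt_sec hp _)
        (contMDiffAt_fst.prodMk contMDiffAt_const)
    exact (B.contMDiff_act.contMDiffAt.comp (B.proj p, (1 : G))
      (h1.prodMk contMDiffAt_snd)).mdifferentiableAt (by simp)
  have hid : (fun q : P => q) =ᶠ[𝓝 p] fun q => h (B.proj q, k q) := by
    filter_upwards [(e.open_baseSet.preimage B.contMDiff_proj.continuous).mem_nhds hp] with q hq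
    have hq : B.proj q ∈ e.baseSet := hq
    change q = B.act (e.sec (B.proj q) (e.fib p)) ((e.fib p)⁻¹ * e.fib q)
    rw [← e.sec_mul hq, mul_inv_cancel_left, e.sec_fib hq]
  have key := flatDeriv_comp_apply (I := IP) (I' := IM.prod IG) (I'' := IP) (g := h)
    (f := fun q => (B.proj q, k q)) p (by rw [hkp]; exact hh)
    ((B.mdifferentiableAt_proj p).prodMk hk) v
  rw [← flatDeriv_congr hid, flatDeriv_id, flatDeriv_prodMk (B.mdifferentiableAt_proj p) hk,
    hkp] at key
  refine ⟨flatDeriv IP IG k p v, ?_⟩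
  change v = flatDeriv (IM.prod IG) IP h (B.proj p, 1)
    (flatDeriv IP IM B.proj p v, flatDeriv IP IG k p v) at key
  rw [hv, flatDeriv_zero_prod hh] at key
  simpa only [h, e.sec_fib hp, gen] using key

/-- Differentiate (p · h) · g = (p · g) · (g⁻¹ h g) at h = 1. The last g is written g⁻¹⁻¹ in the
proof to match `adjointAction` at g⁻¹. -/
theorem transl_gen [LieGroup IG ∞ G] (g : G) (p : P) (u : EG) :
    B.transl g p (B.gen p u) = B.gen (B.act p g) (adjointAction IG g⁻¹ u : EG) := by
  have h1 := flatDeriv_comp_apply (I := IG) (I' := IP) (I'' := IP) (g := fun q => B.act q g)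
    (f := fun h => B.act p h) 1 (B.mdifferentiableAt_act_right _ _)
    (B.mdifferentiableAt_act_left _ _) u
  have hc : MDifferentiableAt IG IG (fun h : G => g⁻¹ * h * g⁻¹⁻¹) 1 :=
    (((contMDiff_const.mul contMDiff_id).mul contMDiff_const : ContMDiff IG IG ∞
      (fun h : G => g⁻¹ * h * g⁻¹⁻¹))).mdifferentiableAt (by simp)
  have h2 := flatDeriv_comp_apply (I := IG) (I' := IG) (I'' := IP)
    (g := fun h => B.act (B.act p g) h) (f := fun h => g⁻¹ * h * g⁻¹⁻¹) 1
    (B.mdifferentiableAt_act_left _ _) hc u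
  have h3 : (fun h => B.act (B.act p g) (g⁻¹ * h * g⁻¹⁻¹)) = fun h => B.act (B.act p h) g := by
    funext h
    simp only [← B.act_mul]
    congr 1
    group
  rw [h3, h1] at h2
  simp only [B.act_one, mul_one, mul_inv_cancel] at h2
  exact h2

end Vertical

/-! ### The differential of the quotient map -/

section Gauge

variable [LieGroup IG ∞ G] [IsManifold IM ∞ M]

/-- The differential of the quotient map `P × P → 𝒢(P)`, between the model spaces. -/
def dToGauge (p q : P) : EP × EP →L[ℝ] (EM × EM) × EG :=
  flatDeriv (IP.prod IP) ((IM.prod IM).prod IG) B.toGauge (p, q)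

theorem mdifferentiableAt_toGauge (z : P × P) :
    MDifferentiableAt (IP.prod IP) ((IM.prod IM).prod IG) B.toGauge z :=
  B.contMDiff_toGauge.mdifferentiableAt (by simp)

theorem flatDeriv_tgt_dToGauge (p q : P) (v w : EP) :
    flatDeriv ((IM.prod IM).prod IG) IM B.tgt (B.toGauge (p, q)) (B.dToGauge p q (v, w)) =
      flatDeriv IP IM B.proj p v := by
  have h := flatDeriv_comp_apply (I'' := IM) (g := B.tgt) (f := B.toGauge) (p, q)
    (B.contMDiff_tgt.mdifferentiableAt (by simp)) (B.mdifferentiableAt_toGauge _) (v, w)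
  refine h.symm.trans ?_
  have h2 := flatDeriv_comp_apply (I := IP.prod IP) (I' := IP) (I'' := IM) (g := B.proj)
    (f := Prod.fst) (p, q) (B.mdifferentiableAt_proj _) mdifferentiableAt_fst (v, w)
  refine h2.trans ?_
  congr 1
  change mfderiv (IP.prod IP) IP Prod.fst (p, q) (v, w) = v
  rw [mfderiv_fst]
  rfl

theorem flatDeriv_src_dToGauge (p q : P) (v w : EP) :
    flatDeriv ((IM.prod IM).prod IG) IM B.src (B.toGauge (p, q)) (B.dToGauge p q (v, w)) =
      flatDeriv IP IM B.proj q w := by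
  have h := flatDeriv_comp_apply (I'' := IM) (g := B.src) (f := B.toGauge) (p, q)
    (B.contMDiff_src.mdifferentiableAt (by simp)) (B.mdifferentiableAt_toGauge _) (v, w)
  refine h.symm.trans ?_
  have h2 := flatDeriv_comp_apply (I := IP.prod IP) (I' := IP) (I'' := IM) (g := B.proj)
    (f := Prod.snd) (p, q) (B.mdifferentiableAt_proj _) mdifferentiableAt_snd (v, w)
  refine h2.trans ?_
  congr 1
  change mfderiv (IP.prod IP) IP Prod.snd (p, q) (v, w) = w
  rw [mfderiv_snd]
  rfl

/-- The map g ↦ \overline{(p · g, q · g)} is constant. -/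
theorem dToGauge_gen_gen (p q : P) (u : EG) : B.dToGauge p q (B.gen p u, B.gen q u) = 0 := by
  have h := flatDeriv_comp_apply (I := IG) (I' := IP.prod IP) (I'' := (IM.prod IM).prod IG)
    (g := B.toGauge) (f := fun g => (B.act p g, B.act q g)) 1 (B.mdifferentiableAt_toGauge _)
    ((B.mdifferentiableAt_act_left p 1).prodMk (B.mdifferentiableAt_act_left q 1)) u
  rw [flatDeriv_prodMk (B.mdifferentiableAt_act_left p 1) (B.mdifferentiableAt_act_left q 1)] at h
  simp only [B.toGauge_act, flatDeriv_const, B.act_one] at h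
  exact h.symm

theorem dToGauge_transl (g : G) (p q : P) (v w : EP) :
    B.dToGauge (B.act p g) (B.act q g) (B.transl g p v, B.transl g q w) =
      B.dToGauge p q (v, w) := by
  have h1 : MDifferentiableAt (IP.prod IP) IP (fun z : P × P => B.act z.1 g) (p, q) :=
    ((B.contMDiff_act_right g).comp contMDiff_fst).mdifferentiableAt (by simp)
  have h2 : MDifferentiableAt (IP.prod IP) IP (fun z : P × P => B.act z.2 g) (p, q) :=
    ((B.contMDiff_act_right g).comp contMDiff_snd).mdifferentiableAt (by simp)
  have h := flatDeriv_comp_apply (I := IP.prod IP) (I' := IP.prod IP)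
    (I'' := (IM.prod IM).prod IG) (g := B.toGauge)
    (f := fun z : P × P => (B.act z.1 g, B.act z.2 g)) (p, q) (B.mdifferentiableAt_toGauge _)
    (h1.prodMk h2) (v, w)
  rw [flatDeriv_prodMk h1 h2] at h
  have h1' := flatDeriv_comp_apply (I := IP.prod IP) (I' := IP) (I'' := IP)
    (g := fun q => B.act q g) (f := Prod.fst) (p, q) (B.mdifferentiableAt_act_right _ _)
    mdifferentiableAt_fst (v, w)
  have h2' := flatDeriv_comp_apply (I := IP.prod IP) (I' := IP) (I'' := IP)
    (g := fun q => B.act q g) (f := Prod.snd) (p, q) (B.mdifferentiableAt_act_right _ _)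
    mdifferentiableAt_snd (v, w)
  have e1 : flatDeriv (IP.prod IP) IP Prod.fst (p, q) (v, w) = v := by
    change mfderiv (IP.prod IP) IP Prod.fst (p, q) (v, w) = v
    rw [mfderiv_fst]; rfl
  have e2 : flatDeriv (IP.prod IP) IP Prod.snd (p, q) (v, w) = w := by
    change mfderiv (IP.prod IP) IP Prod.snd (p, q) (v, w) = w
    rw [mfderiv_snd]; rfl
  rw [e1] at h1'
  rw [e2] at h2'
  rw [ContinuousLinearMap.prod_apply, h1', h2'] at h
  have h3 : (fun z : P × P => B.toGauge (B.act z.1 g, B.act z.2 g)) = B.toGauge :=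
    funext fun z => B.toGauge_act _ _ _
  rw [h3] at h
  exact h.symm

/-- This is the derivative at 1 of `arrowCoord_toGauge_act`. It holds for any trivializations around
p and q, so the recovered u does not depend on them. -/
theorem flatDeriv_arrowCoord_gen (e f : B.LocalTriv) {p q : P} (hp : B.proj p ∈ e.baseSet)
    (hq : B.proj q ∈ f.baseSet) (u : EG) :
    flatDeriv ((IM.prod IM).prod IG) IG (fun z => arrowCoord e f ((p, q), z)) (B.toGauge (p, q))
      (B.dToGauge p q (B.gen p u, 0)) = u := by
  have h0 : ContMDiffAt ((IM.prod IM).prod IG) IG ∞ (fun z => arrowCoord e f ((p, q), z))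
      (B.toGauge (p, q)) :=
    (contMDiffAt_arrowCoord e f hp hq (z := B.toGauge (p, q)) hp hq).comp (B.toGauge (p, q))
      (contMDiffAt_const.prodMk contMDiffAt_id)
  have h1 : MDifferentiableAt IP ((IM.prod IM).prod IG) (fun p' => B.toGauge (p', q)) p :=
    (B.contMDiff_toGauge.comp (contMDiff_id.prodMk contMDiff_const)).mdifferentiableAt (by simp)
  have h2 := flatDeriv_comp_apply (I := IG) (I' := IP) (I'' := (IM.prod IM).prod IG)
    (g := fun p' => B.toGauge (p', q)) (f := fun g => B.act p g) 1 (by rw [B.act_one]; exact h1)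
    (B.mdifferentiableAt_act_left p 1) u
  have h3 := flatDeriv_comp_apply (I := IG) (I' := (IM.prod IM).prod IG) (I'' := IG)
    (g := fun z => arrowCoord e f ((p, q), z)) (f := fun g => B.toGauge (B.act p g, q)) 1
    (by rw [B.act_one]; exact h0.mdifferentiableAt (by simp))
    ((B.contMDiff_toGauge.comp ((B.contMDiff_act_left p).prodMk
      contMDiff_const)).mdifferentiableAt (by simp)) u
  simp only [arrowCoord_toGauge_act e f hp hq, flatDeriv_id, B.act_one] at h2 h3
  rw [h2] at h3
  rw [dToGauge, flatDeriv_prod_zero (B.mdifferentiableAt_toGauge _)]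
  exact h3.symm

theorem dToGauge_gen_zero_injective (p q : P) :
    Function.Injective (fun u => B.dToGauge p q (B.gen p u, 0)) := by
  obtain ⟨e, hp⟩ := B.exists_localTriv (B.proj p)
  obtain ⟨f, hq⟩ := B.exists_localTriv (B.proj q)
  intro u v h
  have := congrArg (flatDeriv ((IM.prod IM).prod IG) IG (fun z => arrowCoord e f ((p, q), z))
    (B.toGauge (p, q))) h
  simpa only [B.flatDeriv_arrowCoord_gen e f hp hq] using this

theorem gen_injective (p : P) : Function.Injective (B.gen p) := by
  intro u v h
  refine B.dToGauge_gen_zero_injective p p ?_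
  simp only [h]

/-- Subtracting the kernel vector (v_P(p), v_P(q)) clears the second leg. This is the normal form of
the elements of Δ_V, unique by `dToGauge_gen_zero_injective`. -/
theorem dToGauge_gen_eq (p q : P) (u v : EG) :
    B.dToGauge p q (B.gen p u, B.gen q v) = B.dToGauge p q (B.gen p (u - v), 0) := by
  have h : (B.gen p u, B.gen q v) = (B.gen p (u - v), 0) + (B.gen p v, B.gen q v) := by
    simp
  rw [h, map_add, dToGauge_gen_gen, add_zero]

/-- Target and source show that v and w are generators of some u and u'; the normal form, which
depends only on u - u', then gives u = u'. -/
theorem dToGauge_eq_zero_iff {p q : P} {v w : EP} :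
    B.dToGauge p q (v, w) = 0 ↔ ∃ u, v = B.gen p u ∧ w = B.gen q u := by
  constructor
  · intro h
    obtain ⟨u, rfl⟩ := B.exists_gen_eq (p := p) (v := v)
      (by rw [← B.flatDeriv_tgt_dToGauge p q v w, h, map_zero])
    obtain ⟨u', rfl⟩ := B.exists_gen_eq (p := q) (v := w)
      (by rw [← B.flatDeriv_src_dToGauge p q _ w, h, map_zero])
    have : u - u' = 0 := B.dToGauge_gen_zero_injective p q (by
      simp only [← B.dToGauge_gen_eq, h, map_zero]
      exact (map_zero _).symm)
    exact ⟨u', by rw [sub_eq_zero.1 this], rfl⟩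
  · rintro ⟨u, rfl, rfl⟩
    exact B.dToGauge_gen_gen p q u

/-- Equality of base points provides g. After translating back by g, both pairs lie over the same
(p, q), and their difference is in the kernel of the differential. -/
theorem tangentToGauge_eq_iff {X Y X' Y' : TangentBundle IP P} :
    B.tangentToGauge X Y = B.tangentToGauge X' Y' ↔
      ∃ (g : G) (u : EG),
        X' = ⟨B.act X.1 g, B.transl g X.1 (flatVec X + B.gen X.1 u)⟩ ∧
        Y' = ⟨B.act Y.1 g, B.transl g Y.1 (flatVec Y + B.gen Y.1 u)⟩ := by
  obtain ⟨p, v⟩ := X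
  obtain ⟨q, w⟩ := Y
  obtain ⟨p', v'⟩ := X'
  obtain ⟨q', w'⟩ := Y'
  change EP at v w v' w'
  constructor
  · intro h
    have h1 : B.toGauge (p, q) = B.toGauge (p', q') := congrArg TotalSpace.proj h
    obtain ⟨g, hg⟩ := B.toGauge_eq_iff.1 h1
    obtain ⟨rfl, rfl⟩ := Prod.mk.injEq .. ▸ hg
    obtain ⟨v₁, rfl⟩ := B.transl_surjective g p v'
    obtain ⟨w₁, rfl⟩ := B.transl_surjective g q w'
    have h2 : B.dToGauge p q (v, w) = B.dToGauge p q (v₁, w₁) := by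
      rw [← B.dToGauge_transl g p q v₁ w₁]
      exact congrArg flatVec h
    have h3 : B.dToGauge p q (v₁ - v, w₁ - w) = 0 := by
      rw [← Prod.mk_sub_mk, map_sub, h2, sub_self]
    obtain ⟨u, hu, hu'⟩ := B.dToGauge_eq_zero_iff.1 h3
    refine ⟨g, u, ?_, ?_⟩
    · simp only [flatVec, ← hu, add_sub_cancel]
    · simp only [flatVec, ← hu', add_sub_cancel]
  · rintro ⟨g, u, h, h'⟩
    rw [h, h']
    refine tangentBundle_ext (B.toGauge_act p q g).symm ?_
    change B.dToGauge p q (v, w) = B.dToGauge (B.act p g) (B.act q g)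
      (B.transl g p (v + B.gen p u), B.transl g q (w + B.gen q u))
    rw [B.dToGauge_transl, ← Prod.mk_add_mk, map_add, B.dToGauge_gen_gen, add_zero]

/-- Push W forward along a local section of the quotient map. -/
theorem exists_tangentToGauge_eq (W : TangentBundle ((IM.prod IM).prod IG) B.GaugeSpace) :
    ∃ X Y, B.tangentToGauge X Y = W := by
  obtain ⟨z, W⟩ := W
  change (EM × EM) × EG at W
  set e := B.trivAt (B.tgt z)
  set f := B.trivAt (B.src z)
  have ht : B.tgt z ∈ e.baseSet := mem_baseSet_trivAt _
  have hs : B.src z ∈ f.baseSet := mem_baseSet_trivAt _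
  have hid : (fun z' => B.toGauge (gaugeSection e f z')) =ᶠ[𝓝 z] fun z' => z' := by
    filter_upwards [(gaugeTriv e f).open_source.mem_nhds ⟨ht, hs⟩] with z' hz'
    exact toGauge_gaugeSection e f hz'.1 hz'.2
  have h := flatDeriv_comp_apply (I'' := (IM.prod IM).prod IG) (g := B.toGauge)
    (f := gaugeSection e f) z (B.mdifferentiableAt_toGauge _)
    ((contMDiffAt_gaugeSection e f ht hs).mdifferentiableAt (by simp)) W
  rw [flatDeriv_congr hid, flatDeriv_id] at h
  let V := flatDeriv ((IM.prod IM).prod IG) (IP.prod IP) (gaugeSection e f) z W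
  refine ⟨⟨(gaugeSection e f z).1, V.1⟩, ⟨(gaugeSection e f z).2, V.2⟩, ?_⟩
  exact tangentBundle_ext (toGauge_gaugeSection e f ht hs) h.symm

end Gauge

/-! ### The multiplication of the tangent groupoid -/

section TangentMul

theorem gaugeMul_eq_toGauge {z w : B.GaugeSpace} (h : B.src z = B.tgt w) {p q r : P}
    (hz : z = B.toGauge (p, q)) (hw : w = B.toGauge (q, r)) :
    B.gaugeMul z w h = B.toGauge (p, r) := by
  subst hz hw
  exact B.gaugeMul_toGauge p q r h

variable [LieGroup IG ∞ G] [IsManifold IM ∞ M]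

theorem velocity_toGauge {p q : ℝ → P} (hp : MDifferentiableAt 𝓘(ℝ, ℝ) IP p 0)
    (hq : MDifferentiableAt 𝓘(ℝ, ℝ) IP q 0) :
    velocity ((IM.prod IM).prod IG) (fun t => B.toGauge (p t, q t)) =
      B.tangentToGauge (velocity IP p) (velocity IP q) := by
  refine tangentBundle_ext rfl ?_
  have h := flatDeriv_comp_apply (I := 𝓘(ℝ, ℝ)) (I' := IP.prod IP) (I'' := (IM.prod IM).prod IG)
    (g := B.toGauge) (f := fun t => (p t, q t)) 0 (B.mdifferentiableAt_toGauge _)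
    (hp.prodMk hq) 1
  rw [flatDeriv_prodMk hp hq] at h
  exact h

/-- Composable curves of arrows lift, near time 0, to curves p, q, r in P with γ = \overline{(p, q)}
and δ = \overline{(q, r)}. Velocities see only this germ. -/
theorem exists_of_isTangentMul {X Y Z : TangentBundle ((IM.prod IM).prod IG) B.GaugeSpace}
    (h : B.gaugeGroupoid.IsTangentMul ((IM.prod IM).prod IG) X Y Z) :
    ∃ S T U, X = B.tangentToGauge S T ∧ Y = B.tangentToGauge T U ∧ Z = B.tangentToGauge S U := by
  obtain ⟨γ, δ, hcomp, hγ, hδ, rfl, rfl, rfl⟩ := h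
  replace hcomp : ∀ t, B.src (γ t) = B.tgt (δ t) := hcomp
  set e := B.trivAt (B.tgt (γ 0))
  set f := B.trivAt (B.src (γ 0))
  set k := B.trivAt (B.src (δ 0))
  have he : B.tgt (γ 0) ∈ e.baseSet := mem_baseSet_trivAt _
  have hf : B.src (γ 0) ∈ f.baseSet := mem_baseSet_trivAt _
  have hk : B.src (δ 0) ∈ k.baseSet := mem_baseSet_trivAt _
  have hf' : B.tgt (δ 0) ∈ f.baseSet := hcomp 0 ▸ hf
  let p : ℝ → P := fun t => (gaugeSection e f (γ t)).1
  let q : ℝ → P := fun t => (gaugeSection e f (γ t)).2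
  -- With a the G-coordinate of δ, its local section is (f⁻¹(tgt δ, a), k⁻¹(src δ, 1)). Acting by
  -- a⁻¹ turns the first leg into f⁻¹(tgt δ, 1), which is q because tgt δ = src γ.
  let r : ℝ → P := fun t => B.act (gaugeSection f k (δ t)).2 ((chartFun f k (δ t)).2)⁻¹
  have hs1 : ContMDiffAt 𝓘(ℝ, ℝ) (IP.prod IP) ∞ (fun t => gaugeSection e f (γ t)) 0 :=
    (contMDiffAt_gaugeSection e f he hf).comp 0 hγ.contMDiffAt
  have hs2 : ContMDiffAt 𝓘(ℝ, ℝ) (IP.prod IP) ∞ (fun t => gaugeSection f k (δ t)) 0 :=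
    (contMDiffAt_gaugeSection f k hf' hk).comp 0 hδ.contMDiffAt
  have hc : ContMDiffAt 𝓘(ℝ, ℝ) IG ∞ (fun t => (chartFun f k (δ t)).2) 0 :=
    contMDiffAt_snd.comp 0 ((contMDiffAt_chartFun f k hf' hk).comp 0 hδ.contMDiffAt)
  have hp : ContMDiffAt 𝓘(ℝ, ℝ) IP ∞ p 0 := contMDiffAt_fst.comp 0 hs1
  have hq : ContMDiffAt 𝓘(ℝ, ℝ) IP ∞ q 0 := contMDiffAt_snd.comp 0 hs1
  have hr : ContMDiffAt 𝓘(ℝ, ℝ) IP ∞ r 0 :=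
    B.contMDiff_act.contMDiffAt.comp 0 ((contMDiffAt_snd.comp 0 hs2).prodMk hc.inv)
  have eγ : ∀ᶠ t in 𝓝 0, γ t = B.toGauge (p t, q t) := by
    filter_upwards [hγ.continuous.continuousAt ((gaugeTriv e f).open_source.mem_nhds ⟨he, hf⟩)]
      with t ht
    exact (toGauge_gaugeSection e f ht.1 ht.2).symm
  have eδ : ∀ᶠ t in 𝓝 0, δ t = B.toGauge (q t, r t) := by
    filter_upwards [hδ.continuous.continuousAt ((gaugeTriv f k).open_source.mem_nhds ⟨hf', hk⟩)]
      with t ht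
    refine (toGauge_gaugeSection f k ht.1 ht.2).symm.trans ?_
    refine (B.toGauge_act _ _ ((chartFun f k (δ t)).2)⁻¹).symm.trans ?_
    have : q t = B.act (gaugeSection f k (δ t)).1 ((chartFun f k (δ t)).2)⁻¹ := by
      change f.sec (B.src (γ t)) 1 = B.act (f.sec (B.tgt (δ t)) (chartFun f k (δ t)).2) _
      rw [hcomp t, ← f.sec_mul ht.1, mul_inv_cancel]
    rw [this]
    rfl
  have eμ : ∀ᶠ t in 𝓝 0, B.gaugeMul (γ t) (δ t) (hcomp t) = B.toGauge (p t, r t) := by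
    filter_upwards [eγ, eδ] with t h1 h2
    exact B.gaugeMul_eq_toGauge _ h1 h2
  have hp' := hp.mdifferentiableAt (by simp)
  have hq' := hq.mdifferentiableAt (by simp)
  have hr' := hr.mdifferentiableAt (by simp)
  exact ⟨velocity IP p, velocity IP q, velocity IP r,
    (velocity_congr eγ).trans (B.velocity_toGauge hp' hq'),
    (velocity_congr eδ).trans (B.velocity_toGauge hq' hr'),
    (velocity_congr eμ).trans (B.velocity_toGauge hp' hr')⟩

/-- In the tangent groupoid, `\overline{(S, T)} · \overline{(T, U)} = \overline{(S, U)}`. -/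
theorem isTangentMul_tangentToGauge [IsManifold IP ∞ P] [IP.Boundaryless] (S T U : TangentBundle IP P) :
    B.gaugeGroupoid.IsTangentMul ((IM.prod IM).prod IG) (B.tangentToGauge S T)
      (B.tangentToGauge T U) (B.tangentToGauge S U) := by
  obtain ⟨p, hp, rfl⟩ := exists_contMDiff_velocity_eq S
  obtain ⟨q, hq, rfl⟩ := exists_contMDiff_velocity_eq T
  obtain ⟨r, hr, rfl⟩ := exists_contMDiff_velocity_eq U
  have hp' := hp.mdifferentiableAt (x := 0) (by simp)
  have hq' := hq.mdifferentiableAt (x := 0) (by simp)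
  have hr' := hr.mdifferentiableAt (x := 0) (by simp)
  refine ⟨fun t => B.toGauge (p t, q t), fun t => B.toGauge (q t, r t), fun t => rfl,
    B.contMDiff_toGauge.comp (hp.prodMk hq), B.contMDiff_toGauge.comp (hq.prodMk hr),
    B.velocity_toGauge hp' hq', B.velocity_toGauge hq' hr', ?_⟩
  rw [← B.velocity_toGauge hp' hr']
  congr 1
  funext t
  exact B.gaugeMul_toGauge (p t) (q t) (r t) rfl

/-- The product in the tangent groupoid is determined by its factors. -/
theorem tangentToGauge_comp_congr {S T U S' T' U' : TangentBundle IP P}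
    (h : B.tangentToGauge S T = B.tangentToGauge S' T')
    (h' : B.tangentToGauge T U = B.tangentToGauge T' U') :
    B.tangentToGauge S U = B.tangentToGauge S' U' := by
  obtain ⟨g, u, hS, hT⟩ := B.tangentToGauge_eq_iff.1 h
  obtain ⟨k, w, hT', hU⟩ := B.tangentToGauge_eq_iff.1 h'
  have h1 := hT.symm.trans hT'
  have h2 : B.act T.1 g = B.act T.1 k := congrArg TotalSpace.proj h1
  -- The shared middle vector T pins down both the group element, by freeness, and the Lie algebra
  -- element, by injectivity of u ↦ u_P. So one pair (g, u) relates the outer legs.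
  have h3 : g = k := by
    refine mul_inv_eq_one.1 (B.act_eq_self (p := T.1) ?_)
    rw [B.act_mul, h2, ← B.act_mul, mul_inv_cancel, B.act_one]
  subst h3
  have h4 : B.transl g T.1 (flatVec T + B.gen T.1 u) = B.transl g T.1 (flatVec T + B.gen T.1 w) :=
    congrArg flatVec h1
  have h5 := B.gen_injective _ (add_left_cancel (B.transl_injective g T.1 h4))
  subst h5
  exact B.tangentToGauge_eq_iff.2 ⟨g, u, hS, hU⟩

/-- `IsTangentMul` only asserts that suitable curves exist; this makes it a partial function, so
that products can be compared. -/
theorem isTangentMul_unique {S T U : TangentBundle IP P}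
    {Z : TangentBundle ((IM.prod IM).prod IG) B.GaugeSpace}
    (h : B.gaugeGroupoid.IsTangentMul ((IM.prod IM).prod IG) (B.tangentToGauge S T)
      (B.tangentToGauge T U) Z) : Z = B.tangentToGauge S U := by
  obtain ⟨S', T', U', h1, h2, rfl⟩ := B.exists_of_isTangentMul h
  exact (B.tangentToGauge_comp_congr h1 h2).symm

end TangentMul

/-! ### The one-form of a principal connection -/

section OfConnection

variable [LieGroup IG ∞ G] [IsManifold IM ∞ M] [IsManifold IP ∞ P]
variable {B}

/-- The values of a connection, between the model spaces. -/
def PrincipalConnection.flat (θ : B.PrincipalConnection) (p : P) : EP →L[ℝ] EG := θ.toFun p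

omit [LieGroup IG ∞ G] [IsManifold IM ∞ M] in
theorem PrincipalConnection.flat_gen (θ : B.PrincipalConnection) (p : P) (u : EG) :
    θ.flat p (B.gen p u) = u := θ.map_generator p u

omit [LieGroup IG ∞ G] [IsManifold IM ∞ M] in
theorem PrincipalConnection.flat_transl (θ : B.PrincipalConnection) (g : G) (p : P) (v : EP) :
    θ.flat (B.act p g) (B.transl g p v) = (adjointAction IG g⁻¹ (θ.flat p v) : EG) :=
  θ.map_act p g v

/-- The vertical projection on `T_p P`, between the model spaces. -/
def PrincipalConnection.vert (θ : B.PrincipalConnection) (p : P) : EP →L[ℝ] EP :=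
  (B.gen p).comp (θ.flat p)

-- The same Ad_{g⁻¹} appears in the equivariance of θ and in the translation of generators.
omit [IsManifold IM ∞ M] in
theorem PrincipalConnection.vert_transl (θ : B.PrincipalConnection) (g : G) (p : P) (v : EP) :
    θ.vert (B.act p g) (B.transl g p v) = B.transl g p (θ.vert p v) := by
  simp only [vert, ContinuousLinearMap.comp_apply, θ.flat_transl, B.transl_gen]

omit [LieGroup IG ∞ G] [IsManifold IM ∞ M] in
theorem PrincipalConnection.vert_gen (θ : B.PrincipalConnection) (p : P) (u : EG) :
    θ.vert p (B.gen p u) = B.gen p u := by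
  simp only [vert, ContinuousLinearMap.comp_apply, θ.flat_gen]

omit [LieGroup IG ∞ G] [IsManifold IM ∞ M] in
theorem PrincipalConnection.verticalProjection_mem (θ : B.PrincipalConnection)
    (X : TangentBundle IP P) : θ.verticalProjection X ∈ B.verticalBundle :=
  ⟨θ.toFun X.1 X.2, rfl⟩

omit [LieGroup IG ∞ G] [IsManifold IM ∞ M] in
theorem PrincipalConnection.verticalProjection_of_mem (θ : B.PrincipalConnection)
    {X : TangentBundle IP P} (hX : X ∈ B.verticalBundle) : θ.verticalProjection X = X := by
  obtain ⟨u, hu⟩ := hX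
  refine tangentBundle_ext rfl ?_
  change θ.vert X.1 X.2 = X.2
  rw [hu]
  exact θ.vert_gen X.1 u

/-- The formula for K is well defined: Θ commutes with translation by g and fixes the added u_P, so
the same (g, u) relates the projected pairs. -/
theorem PrincipalConnection.tangentToGauge_verticalProjection_congr (θ : B.PrincipalConnection)
    {X Y X' Y' : TangentBundle IP P} (h : B.tangentToGauge X Y = B.tangentToGauge X' Y') :
    B.tangentToGauge (θ.verticalProjection X) (θ.verticalProjection Y) =
      B.tangentToGauge (θ.verticalProjection X') (θ.verticalProjection Y') := by
  obtain ⟨g, u, rfl, rfl⟩ := B.tangentToGauge_eq_iff.1 h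
  refine B.tangentToGauge_eq_iff.2 ⟨g, u, ?_, ?_⟩ <;>
  · refine tangentBundle_ext rfl ?_
    refine (θ.vert_transl g _ _).trans ?_
    rw [map_add, θ.vert_gen]
    rfl

-- Θ(X) is the image of (0_p, θ(X)) ∈ T_pP × T₁G under the tangent map of the action, and θ is
-- smooth.
omit [IsManifold IM ∞ M] in
theorem PrincipalConnection.contMDiff_verticalProjection (θ : B.PrincipalConnection) :
    ContMDiff IP.tangent IP.tangent ∞ θ.verticalProjection := by
  have : IsManifold IG ∞ G := ContMDiffMul.toIsManifold
  have : IsManifold IP 1 P := .of_le (n := ∞) (by simp)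
  have : IsManifold IG 1 G := .of_le (n := ∞) (by simp)
  intro X
  have h1 : ContMDiffAt IP.tangent IP.tangent ∞
      (fun Y : TangentBundle IP P => (⟨Y.1, (0 : EP)⟩ : TangentBundle IP P)) X :=
    ((contMDiff_zeroSection ℝ (TangentSpace IP : P → Type _)).comp
      (Bundle.contMDiff_proj (TangentSpace IP : P → Type _))).contMDiffAt
  have h2 : ContMDiffAt IP.tangent IG.tangent ∞
      (fun Y : TangentBundle IP P => (⟨(1 : G), θ.flat Y.1 Y.2⟩ : TangentBundle IG G)) X :=
    contMDiffAt_tangentSpace_iff.2 (θ.contMDiff_toFun X)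
  have h3 := (B.contMDiff_act.contMDiff_tangentMap (m := ∞) (by simp)).contMDiffAt.comp X
    (h1.tangentPair h2)
  convert h3 using 1
  funext Y
  refine tangentBundle_ext (B.act_one _).symm ?_
  exact (flatDeriv_zero_prod (f := fun z : P × G => B.act z.1 z.2)
    (B.contMDiff_act.mdifferentiableAt (by simp)) (θ.flat Y.1 Y.2)).symm

/-- `K_z`, between the model spaces, computed through a local section of `P × P → 𝒢(P)`. -/
def PrincipalConnection.gaugeFormAux (θ : B.PrincipalConnection) (e f : B.LocalTriv)
    (z : B.GaugeSpace) : (EM × EM) × EG →L[ℝ] (EM × EM) × EG :=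
  ((B.dToGauge (gaugeSection e f z).1 (gaugeSection e f z).2).comp
    ((θ.vert (gaugeSection e f z).1).prodMap (θ.vert (gaugeSection e f z).2))).comp
    (flatDeriv ((IM.prod IM).prod IG) (IP.prod IP) (gaugeSection e f) z)

/-- The tangent map of the section merely picks another representative of \overline{(X, Y)}, and the
class of (ΘX, ΘY) does not depend on the representative. -/
theorem PrincipalConnection.gaugeFormAux_tangentToGauge (θ : B.PrincipalConnection)
    (e f : B.LocalTriv) {X Y : TangentBundle IP P} (hX : B.proj X.1 ∈ e.baseSet)
    (hY : B.proj Y.1 ∈ f.baseSet) :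
    (⟨B.toGauge (X.1, Y.1), θ.gaugeFormAux e f (B.toGauge (X.1, Y.1))
        (B.dToGauge X.1 Y.1 (flatVec X, flatVec Y))⟩ :
        TangentBundle ((IM.prod IM).prod IG) B.GaugeSpace) =
      B.tangentToGauge (θ.verticalProjection X) (θ.verticalProjection Y) := by
  set z := B.toGauge (X.1, Y.1) with hz
  set W := B.dToGauge X.1 Y.1 (flatVec X, flatVec Y) with hW
  set s := gaugeSection e f z with hs
  set V := flatDeriv ((IM.prod IM).prod IG) (IP.prod IP) (gaugeSection e f) z W with hV
  have hsz : B.toGauge s = z := toGauge_gaugeSection e f hX hY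
  have hid : (fun z' => B.toGauge (gaugeSection e f z')) =ᶠ[𝓝 z] fun z' => z' := by
    filter_upwards [(gaugeTriv e f).open_source.mem_nhds (x := z) ⟨hX, hY⟩] with z' hz'
    exact toGauge_gaugeSection e f hz'.1 hz'.2
  have h := flatDeriv_comp_apply (I'' := (IM.prod IM).prod IG) (g := B.toGauge)
    (f := gaugeSection e f) z (B.mdifferentiableAt_toGauge _)
    ((contMDiffAt_gaugeSection e f (z := z) hX hY).mdifferentiableAt (by simp)) W
  rw [flatDeriv_congr hid, flatDeriv_id] at h
  have h1 : B.tangentToGauge (⟨s.1, V.1⟩ : TangentBundle IP P) ⟨s.2, V.2⟩ =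
      B.tangentToGauge X Y := tangentBundle_ext hsz h.symm
  rw [← θ.tangentToGauge_verticalProjection_congr h1]
  exact tangentBundle_ext hsz.symm rfl

/-- The vector-valued one-form `\overline{(X, Y)} ↦ \overline{(Θ X, Θ Y)}` on the gauge groupoid. -/
def PrincipalConnection.gaugeForm (θ : B.PrincipalConnection) :
    VectorValuedOneForm ((IM.prod IM).prod IG) B.GaugeSpace where
  toFun z := θ.gaugeFormAux (B.trivAt (B.tgt z)) (B.trivAt (B.src z)) z
  contMDiff_toFun := by
    intro W₀
    set e := B.trivAt (B.tgt W₀.1)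
    set f := B.trivAt (B.src W₀.1)
    have ht : B.tgt W₀.1 ∈ e.baseSet := mem_baseSet_trivAt _
    have hs : B.src W₀.1 ∈ f.baseSet := mem_baseSet_trivAt _
    have : IsManifold IP 1 P := .of_le (n := ∞) (by simp)
    have hS : ContMDiffOn ((IM.prod IM).prod IG) (IP.prod IP) ∞ (gaugeSection e f)
        (gaugeTriv e f).source := fun z hz =>
      (contMDiffAt_gaugeSection e f hz.1 hz.2).contMDiffWithinAt
    have hU : TotalSpace.proj ⁻¹' (gaugeTriv e f).source ∈ 𝓝 W₀ :=
      ((gaugeTriv e f).open_source.preimage (Bundle.contMDiff_proj (n := ∞) (IB := (IM.prod IM).prod IG)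
        (TangentSpace ((IM.prod IM).prod IG) : B.GaugeSpace → Type _)).continuous).mem_nhds
        ⟨ht, hs⟩
    have h1 := (hS.contMDiffOn_tangentMap_of_isOpen (gaugeTriv e f).open_source).contMDiffAt hU
    have h2 := (contMDiff_equivTangentBundleProd (n := ∞) (I := IP) (M := P) (I' := IP)
      (M' := P)).contMDiffAt.comp W₀ h1
    have h4 := (B.contMDiff_toGauge.contMDiff_tangentMap (m := ∞) (by simp)).contMDiffAt.comp W₀
      ((θ.contMDiff_verticalProjection.contMDiffAt.comp W₀ h2.fst).tangentPair
        (θ.contMDiff_verticalProjection.contMDiffAt.comp W₀ h2.snd))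
    refine h4.congr_of_eventuallyEq ?_
    filter_upwards [hU] with W hW
    obtain ⟨X, Y, rfl⟩ := B.exists_tangentToGauge_eq W
    -- The trivializations in `toFun` vary with the base point. Both they and the fixed `e`, `f`
    -- compute \overline{(ΘX, ΘY)}, so near W₀ the fixed ones may be used.
    refine (θ.gaugeFormAux_tangentToGauge (X := X) (Y := Y) _ _ (mem_baseSet_trivAt _)
      (mem_baseSet_trivAt _)).trans ?_
    refine (θ.gaugeFormAux_tangentToGauge (X := X) (Y := Y) e f hW.1 hW.2).symm.trans ?_
    refine tangentBundle_ext (toGauge_gaugeSection e f hW.1 hW.2).symm rfl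

theorem PrincipalConnection.gaugeForm_tangentToGauge (θ : B.PrincipalConnection)
    (X Y : TangentBundle IP P) :
    θ.gaugeForm.map (B.tangentToGauge X Y) =
      B.tangentToGauge (θ.verticalProjection X) (θ.verticalProjection Y) :=
  θ.gaugeFormAux_tangentToGauge _ _ (mem_baseSet_trivAt _) (mem_baseSet_trivAt _)

theorem PrincipalConnection.gaugeForm_gaugeForm (θ : B.PrincipalConnection)
    (W : TangentBundle ((IM.prod IM).prod IG) B.GaugeSpace) :
    θ.gaugeForm.map (θ.gaugeForm.map W) = θ.gaugeForm.map W := by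
  obtain ⟨X, Y, rfl⟩ := B.exists_tangentToGauge_eq W
  simp only [gaugeForm_tangentToGauge, θ.verticalProjection_of_mem (θ.verticalProjection_mem _)]

theorem PrincipalConnection.range_gaugeForm (θ : B.PrincipalConnection) :
    Set.range θ.gaugeForm.map = B.gaugeVertical := by
  ext W
  constructor
  · rintro ⟨W, rfl⟩
    obtain ⟨X, Y, rfl⟩ := B.exists_tangentToGauge_eq W
    exact ⟨_, θ.verticalProjection_mem X, _, θ.verticalProjection_mem Y,
      (θ.gaugeForm_tangentToGauge X Y).symm⟩
  · rintro ⟨X, hX, Y, hY, rfl⟩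
    refine ⟨B.tangentToGauge X Y, ?_⟩
    rw [gaugeForm_tangentToGauge, θ.verticalProjection_of_mem hX, θ.verticalProjection_of_mem hY]

theorem PrincipalConnection.isMultiplicative_gaugeForm [IP.Boundaryless]
    (θ : B.PrincipalConnection) : B.gaugeGroupoid.IsMultiplicative IM θ.gaugeForm := by
  -- The form K_M is zero, since Θ takes vertical values and these are killed by the differential of
  -- π.
  let Z : VectorValuedOneForm IM M :=
    { toFun := fun _ => 0
      contMDiff_toFun := (contMDiff_zeroSection ℝ (TangentSpace IM : M → Type _)).comp
        (Bundle.contMDiff_proj (TangentSpace IM : M → Type _)) }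
  refine ⟨Z, fun W => ?_, fun W => ?_, fun X Y Z h => ?_⟩
  · obtain ⟨X, Y, rfl⟩ := B.exists_tangentToGauge_eq W
    rw [gaugeForm_tangentToGauge]
    refine tangentBundle_ext rfl ?_
    exact (B.flatDeriv_src_dToGauge X.1 Y.1 _ _).trans (B.flatDeriv_proj_gen _ _)
  · obtain ⟨X, Y, rfl⟩ := B.exists_tangentToGauge_eq W
    rw [gaugeForm_tangentToGauge]
    refine tangentBundle_ext rfl ?_
    exact (B.flatDeriv_tgt_dToGauge X.1 Y.1 _ _).trans (B.flatDeriv_proj_gen _ _)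
  · obtain ⟨S, T, U, rfl, rfl, rfl⟩ := B.exists_of_isTangentMul h
    simp only [gaugeForm_tangentToGauge]
    exact B.isTangentMul_tangentToGauge _ _ _

theorem PrincipalConnection.gaugeForm_injective :
    Function.Injective (PrincipalConnection.gaugeForm (B := B)) := by
  intro θ θ' h
  ext p v
  refine B.dToGauge_gen_zero_injective p p ?_
  -- Evaluated on \overline{(v, 0_p)}, the form of θ gives the normal form \overline{(θ(v)_P, 0_p)},
  -- which determines θ(v).
  have h1 := congrArg (fun K => flatVec (K.map (B.tangentToGauge ⟨p, v⟩ ⟨p, (0 : EP)⟩))) h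
  simp only [gaugeForm_tangentToGauge] at h1
  change B.dToGauge p p (θ.vert p v, θ.vert p 0) = B.dToGauge p p (θ'.vert p v, θ'.vert p 0) at h1
  rw [map_zero, map_zero] at h1
  exact h1

end OfConnection

/-! ### The connection of a multiplicative projection onto `Δ_V` -/

section ToConnection

variable [LieGroup IG ∞ G] [IsManifold IM ∞ M]
variable {B}
variable (K : VectorValuedOneForm ((IM.prod IM).prod IG) B.GaugeSpace)

/-- The values of a vector-valued one-form on the gauge groupoid, between the model spaces. -/
def formFlat (z : B.GaugeSpace) : (EM × EM) × EG →L[ℝ] (EM × EM) × EG := K.toFun z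

/-- Translating a vertical representative to the prescribed point (p, q) keeps it vertical, by
`transl_gen`; then the second leg is cleared. -/
theorem exists_eq_of_mem_gaugeVertical {W : TangentBundle ((IM.prod IM).prod IG) B.GaugeSpace}
    (hW : W ∈ B.gaugeVertical) {p q : P} (h : W.1 = B.toGauge (p, q)) :
    ∃ u, flatVec W = B.dToGauge p q (B.gen p u, 0) := by
  obtain ⟨⟨p', v⟩, ⟨a, ha⟩, ⟨q', w⟩, ⟨b, hb⟩, rfl⟩ := hW
  obtain ⟨g, hg⟩ := B.toGauge_eq_iff.1 (show B.toGauge (p', q') = B.toGauge (p, q) from h)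
  obtain ⟨rfl, rfl⟩ := Prod.mk.inj hg
  change EG at a b
  obtain rfl : v = B.gen p' a := ha
  obtain rfl : w = B.gen q' b := hb
  refine ⟨_, Eq.trans ?_ (B.dToGauge_gen_eq _ _ (adjointAction IG g⁻¹ a : EG)
    (adjointAction IG g⁻¹ b : EG))⟩
  rw [← B.transl_gen, ← B.transl_gen, B.dToGauge_transl]
  rfl

variable {K}

theorem exists_formFlat_eq (hrange : Set.range K.map = B.gaugeVertical) (p q : P) (v w : EP) :
    ∃ u, formFlat K (B.toGauge (p, q)) (B.dToGauge p q (v, w)) = B.dToGauge p q (B.gen p u, 0) :=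
  exists_eq_of_mem_gaugeVertical
    (W := K.map (B.tangentToGauge (⟨p, v⟩ : TangentBundle IP P) ⟨q, w⟩))
    (hrange ▸ mem_range_self _) rfl

/-- An idempotent map is the identity on its range, here Δ_V. -/
theorem formFlat_gen (hidem : ∀ W, K.map (K.map W) = K.map W)
    (hrange : Set.range K.map = B.gaugeVertical) (p q : P) (u w : EG) :
    formFlat K (B.toGauge (p, q)) (B.dToGauge p q (B.gen p u, B.gen q w)) =
      B.dToGauge p q (B.gen p u, B.gen q w) := by
  have h : B.tangentToGauge (⟨p, B.gen p u⟩ : TangentBundle IP P) ⟨q, B.gen q w⟩ ∈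
      Set.range K.map := by
    rw [hrange]
    exact ⟨_, ⟨u, rfl⟩, _, ⟨w, rfl⟩, rfl⟩
  obtain ⟨W, hW⟩ := h
  have h1 := hidem W
  rw [hW] at h1
  exact congrArg flatVec h1

variable (K) in
/-- The connection form of a one-form `K` on the gauge groupoid: if
`K \overline{(v, 0_p)} = \overline{(u_P(p), 0_p)}`, then its value on `v ∈ T_p P` is `u`. -/
def connectionForm (p : P) : EP →L[ℝ] EG :=
  ((flatDeriv ((IM.prod IM).prod IG) IG
    (fun z => arrowCoord (B.trivAt (B.proj p)) (B.trivAt (B.proj p)) ((p, p), z))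
    (B.toGauge (p, p))).comp (formFlat K (B.toGauge (p, p)))).comp
    ((B.dToGauge p p).comp (ContinuousLinearMap.inl ℝ EP EP))

/-- Defining `connectionForm` through the derivative of `arrowCoord` makes it linear and continuous
at once; the range condition then shows that it has the property for which it was made. -/
theorem formFlat_diag (hrange : Set.range K.map = B.gaugeVertical) (p : P) (v : EP) :
    formFlat K (B.toGauge (p, p)) (B.dToGauge p p (v, 0)) =
      B.dToGauge p p (B.gen p (connectionForm K p v), 0) := by
  obtain ⟨u, hu⟩ := exists_formFlat_eq hrange p p v 0
  have h := congrArg (flatDeriv ((IM.prod IM).prod IG) IG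
    (fun z => arrowCoord (B.trivAt (B.proj p)) (B.trivAt (B.proj p)) ((p, p), z))
    (B.toGauge (p, p))) hu
  rw [B.flatDeriv_arrowCoord_gen _ _ (mem_baseSet_trivAt _) (mem_baseSet_trivAt _)] at h
  rw [hu, show connectionForm K p v = u from h]

theorem connectionForm_gen (hidem : ∀ W, K.map (K.map W) = K.map W)
    (hrange : Set.range K.map = B.gaugeVertical) (p : P) (u : EG) :
    connectionForm K p (B.gen p u) = u := by
  refine B.dToGauge_gen_zero_injective p p ?_
  have := formFlat_gen hidem hrange p p u 0
  rw [map_zero] at this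
  exact (formFlat_diag hrange p _).symm.trans this

/-- Translation by g does not change the class \overline{(v, 0_p)}, hence not its image under K.
Comparing normal forms at p and at p · g introduces Ad_{g⁻¹} through `transl_gen`. -/
theorem connectionForm_transl (hrange : Set.range K.map = B.gaugeVertical) (g : G) (p : P)
    (v : EP) :
    connectionForm K (B.act p g) (B.transl g p v) =
      (adjointAction IG g⁻¹ (connectionForm K p v) : EG) := by
  refine B.dToGauge_gen_zero_injective (B.act p g) (B.act p g) ?_
  have h0 : ∀ w : EP, B.dToGauge (B.act p g) (B.act p g) (B.transl g p w, 0) =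
      B.dToGauge p p (w, 0) := fun w => by
    rw [← B.dToGauge_transl g p p w 0, map_zero]
  refine (formFlat_diag hrange _ _).symm.trans ?_
  refine Eq.trans ?_ (congrArg (fun w => B.dToGauge (B.act p g) (B.act p g) (w, 0))
    (B.transl_gen g p (connectionForm K p v)))
  simp only [h0, B.toGauge_act]
  exact formFlat_diag hrange p v

variable [IsManifold IP ∞ P]

/-- Apply K to \overline{(v, 0_p)} · \overline{(0_p, 0_q)} = \overline{(v, 0_q)}: the first factor
lies over a unit, where `formFlat_diag` applies, and the second is a zero vector. -/
theorem formFlat_left [IP.Boundaryless] (hm : B.gaugeGroupoid.IsMultiplicative IM K)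
    (hrange : Set.range K.map = B.gaugeVertical) (p q : P) (v : EP) :
    formFlat K (B.toGauge (p, q)) (B.dToGauge p q (v, 0)) =
      B.dToGauge p q (B.gen p (connectionForm K p v), 0) := by
  obtain ⟨-, -, -, hmul⟩ := hm
  have h := hmul _ _ _ (B.isTangentMul_tangentToGauge (⟨p, v⟩ : TangentBundle IP P)
    ⟨p, (0 : EP)⟩ ⟨q, (0 : EP)⟩)
  have h1 : K.map (B.tangentToGauge (⟨p, v⟩ : TangentBundle IP P) ⟨p, (0 : EP)⟩) =
      B.tangentToGauge (⟨p, B.gen p (connectionForm K p v)⟩ : TangentBundle IP P)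
        ⟨p, (0 : EP)⟩ :=
    tangentBundle_ext rfl (formFlat_diag hrange p v)
  have h2 : K.map (B.tangentToGauge (⟨p, (0 : EP)⟩ : TangentBundle IP P) ⟨q, (0 : EP)⟩) =
      B.tangentToGauge (⟨p, (0 : EP)⟩ : TangentBundle IP P) ⟨q, (0 : EP)⟩ := by
    refine tangentBundle_ext rfl ?_
    change formFlat K (B.toGauge (p, q)) (B.dToGauge p q (0, 0)) = B.dToGauge p q (0, 0)
    rw [Prod.mk_zero_zero, map_zero, map_zero]
  rw [h1, h2] at h
  exact congrArg flatVec (B.isTangentMul_unique h)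

/-- Apply K to \overline{(0_p, w)} · \overline{(w, 0_p)} = \overline{(0_p, 0_p)}. The second factor
is known from `formFlat_left` and the product is zero, so the first is determined. -/
theorem formFlat_right [IP.Boundaryless] (hm : B.gaugeGroupoid.IsMultiplicative IM K)
    (hrange : Set.range K.map = B.gaugeVertical) (p q : P) (w : EP) :
    formFlat K (B.toGauge (p, q)) (B.dToGauge p q (0, w)) =
      B.dToGauge p q (0, B.gen q (connectionForm K q w)) := by
  obtain ⟨a, ha⟩ := exists_formFlat_eq hrange p q 0 w
  have hleft := formFlat_left hm hrange q p w
  obtain ⟨-, -, -, hmul⟩ := hm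
  set u := connectionForm K q w
  have h := hmul _ _ _ (B.isTangentMul_tangentToGauge (⟨p, (0 : EP)⟩ : TangentBundle IP P)
    ⟨q, w⟩ ⟨p, (0 : EP)⟩)
  -- Adding the generator of u to both legs of \overline{(a_P, 0_q)} makes its right leg equal to
  -- the left leg u_P(q) of the other factor. The product is then \overline{((a + u)_P, 0_p)}, and
  -- its vanishing gives a = -u.
  have h1 : K.map (B.tangentToGauge (⟨p, (0 : EP)⟩ : TangentBundle IP P) ⟨q, w⟩) =
      B.tangentToGauge (⟨p, B.gen p (a + u)⟩ : TangentBundle IP P) ⟨q, B.gen q u⟩ := by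
    refine tangentBundle_ext rfl (ha.trans ?_)
    change _ = B.dToGauge p q (B.gen p (a + u), B.gen q u)
    rw [B.dToGauge_gen_eq, add_sub_cancel_right]
  have h2 : K.map (B.tangentToGauge (⟨q, w⟩ : TangentBundle IP P) ⟨p, (0 : EP)⟩) =
      B.tangentToGauge (⟨q, B.gen q u⟩ : TangentBundle IP P) ⟨p, (0 : EP)⟩ :=
    tangentBundle_ext rfl hleft
  rw [h1, h2] at h
  have h3 : formFlat K (B.toGauge (p, p)) (B.dToGauge p p (0, 0)) =
      B.dToGauge p p (B.gen p (a + u), 0) := congrArg flatVec (B.isTangentMul_unique h)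
  have h4 : a + u = 0 := by
    refine B.dToGauge_gen_zero_injective p p (h3.symm.trans ?_)
    simp only [Prod.mk_zero_zero, map_zero]
  rw [ha, eq_neg_of_add_eq_zero_left h4]
  have h5 := B.dToGauge_gen_eq p q 0 u
  rw [map_zero, zero_sub] at h5
  exact h5.symm

theorem map_tangentToGauge [IP.Boundaryless] (hm : B.gaugeGroupoid.IsMultiplicative IM K)
    (hrange : Set.range K.map = B.gaugeVertical) (X Y : TangentBundle IP P) :
    K.map (B.tangentToGauge X Y) =
      B.tangentToGauge (⟨X.1, B.gen X.1 (connectionForm K X.1 (flatVec X))⟩ : TangentBundle IP P)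
        ⟨Y.1, B.gen Y.1 (connectionForm K Y.1 (flatVec Y))⟩ := by
  refine tangentBundle_ext rfl ?_
  change formFlat K (B.toGauge (X.1, Y.1)) (B.dToGauge X.1 Y.1 (flatVec X, flatVec Y)) =
    B.dToGauge X.1 Y.1 (B.gen X.1 (connectionForm K X.1 (flatVec X)),
      B.gen Y.1 (connectionForm K Y.1 (flatVec Y)))
  have hsplit : ∀ a b : EP, (a, b) = (a, (0 : EP)) + ((0 : EP), b) := fun a b => by simp
  rw [hsplit (flatVec X), map_add, map_add, formFlat_left hm hrange, formFlat_right hm hrange,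
    ← map_add, ← hsplit]

/-- The trivialization inside `connectionForm` changes with p, so smoothness is not visible from the
definition. Near X₀ the value is obtained instead from the tangent map of `arrowCoord e e`, with e
fixed, on the smooth family (0, 0, K \overline{(X, 0)}). -/
theorem contMDiff_connectionForm (hrange : Set.range K.map = B.gaugeVertical) :
    ContMDiff IP.tangent 𝓘(ℝ, EG) ∞
      (fun X : TangentBundle IP P => connectionForm K X.1 (flatVec X)) := by
  have : IsManifold IG ∞ G := ContMDiffMul.toIsManifold
  have : IsManifold IP 1 P := .of_le (n := ∞) (by simp)
  intro X₀
  set e := B.trivAt (B.proj X₀.1)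
  have he : B.proj X₀.1 ∈ e.baseSet := mem_baseSet_trivAt _
  have hπ : ContMDiff IP.tangent IM ∞ (fun X : TangentBundle IP P => B.proj X.1) :=
    B.contMDiff_proj.comp (Bundle.contMDiff_proj (TangentSpace IP : P → Type _))
  have hU : {X : TangentBundle IP P | B.proj X.1 ∈ e.baseSet} ∈ 𝓝 X₀ :=
    (e.open_baseSet.preimage hπ.continuous).mem_nhds he
  have h0 : ContMDiffAt IP.tangent IP.tangent ∞
      (fun Y : TangentBundle IP P => (⟨Y.1, (0 : EP)⟩ : TangentBundle IP P)) X₀ :=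
    ((contMDiff_zeroSection ℝ (TangentSpace IP : P → Type _)).comp
      (Bundle.contMDiff_proj (TangentSpace IP : P → Type _))).contMDiffAt
  have h1 : ContMDiffAt IP.tangent ((IM.prod IM).prod IG).tangent ∞
      (fun Y : TangentBundle IP P =>
        K.map (B.tangentToGauge Y (⟨Y.1, (0 : EP)⟩ : TangentBundle IP P))) X₀ :=
    K.contMDiff_toFun.contMDiffAt.comp X₀
      ((B.contMDiff_toGauge.contMDiff_tangentMap (m := ∞) (by simp)).contMDiffAt.comp X₀
        (contMDiffAt_id.tangentPair h0))
  let s : Set ((P × P) × B.GaugeSpace) :=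
    {w | (B.proj w.1.1 ∈ e.baseSet ∧ B.proj w.1.2 ∈ e.baseSet) ∧
      B.tgt w.2 ∈ e.baseSet ∧ B.src w.2 ∈ e.baseSet}
  have hs : IsOpen s := by
    have hc := B.contMDiff_proj.continuous
    have ht := B.continuous_tgt
    have hs := B.continuous_src
    have hb := e.open_baseSet
    exact ((hb.preimage (hc.comp (continuous_fst.comp continuous_fst))).inter
      (hb.preimage (hc.comp (continuous_snd.comp continuous_fst)))).inter
      ((hb.preimage (ht.comp continuous_snd)).inter (hb.preimage (hs.comp continuous_snd)))
  have h2 : ContMDiffOn ((IP.prod IP).prod ((IM.prod IM).prod IG)) IG ∞ (arrowCoord e e) s :=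
    fun w hw => (contMDiffAt_arrowCoord e e hw.1.1 hw.1.2 hw.2.1 hw.2.2).contMDiffWithinAt
  have h3 := (h2.contMDiffOn_tangentMap_of_isOpen hs).contMDiffAt
    ((hs.preimage (Bundle.contMDiff_proj (n := ∞)
      (IB := (IP.prod IP).prod ((IM.prod IM).prod IG))
      (TangentSpace ((IP.prod IP).prod ((IM.prod IM).prod IG)) :
        (P × P) × B.GaugeSpace → Type _)).continuous).mem_nhds
      (x := tangentPair (tangentPair (⟨X₀.1, (0 : EP)⟩ : TangentBundle IP P)
        (⟨X₀.1, (0 : EP)⟩ : TangentBundle IP P))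
        (K.map (B.tangentToGauge X₀ (⟨X₀.1, (0 : EP)⟩ : TangentBundle IP P))))
      ⟨⟨he, he⟩, he, he⟩)
  have h4 := h3.comp X₀ ((h0.tangentPair h0).tangentPair h1)
  refine (contMDiffAt_tangentSpace_iff (I := IG) (a := (1 : G))).1
    (h4.congr_of_eventuallyEq ?_)
  filter_upwards [hU] with X hX
  -- At units `arrowCoord` equals 1, so the tangent vectors obtained all lie in T₁G, as
  -- `contMDiffAt_tangentSpace_iff` requires.
  have hone : arrowCoord e e ((X.1, X.1), B.toGauge (X.1, X.1)) = 1 := by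
    have := arrowCoord_toGauge_act e e hX hX 1
    rwa [B.act_one] at this
  refine tangentBundle_ext hone.symm ?_
  change connectionForm K X.1 (flatVec X) =
    flatDeriv ((IP.prod IP).prod ((IM.prod IM).prod IG)) IG (arrowCoord e e)
      ((X.1, X.1), B.toGauge (X.1, X.1))
      (0, formFlat K (B.toGauge (X.1, X.1)) (B.dToGauge X.1 X.1 (flatVec X, 0)))
  rw [flatDeriv_zero_prod ((contMDiffAt_arrowCoord e e (z := B.toGauge (X.1, X.1)) hX hX hX
    hX).mdifferentiableAt (by simp)), formFlat_diag hrange,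
    B.flatDeriv_arrowCoord_gen e e hX hX]

/-- The principal connection of a projection `K` of the gauge groupoid with image `Δ_V`. -/
def connectionOfForm (hidem : ∀ W, K.map (K.map W) = K.map W)
    (hrange : Set.range K.map = B.gaugeVertical) : B.PrincipalConnection where
  toFun p := (connectionForm K p : EP →L[ℝ] EG)
  contMDiff_toFun := contMDiff_connectionForm hrange
  map_generator p u := connectionForm_gen hidem hrange p u
  map_act p g X := connectionForm_transl hrange g p X

theorem gaugeForm_connectionOfForm [IP.Boundaryless]
    (hm : B.gaugeGroupoid.IsMultiplicative IM K) (hidem : ∀ W, K.map (K.map W) = K.map W)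
    (hrange : Set.range K.map = B.gaugeVertical) :
    (connectionOfForm hidem hrange).gaugeForm = K := by
  have h : ∀ W, (connectionOfForm hidem hrange).gaugeForm.map W = K.map W := fun W => by
    obtain ⟨X, Y, rfl⟩ := B.exists_tangentToGauge_eq W
    rw [PrincipalConnection.gaugeForm_tangentToGauge, map_tangentToGauge hm hrange]
    rfl
  ext z w
  exact congrArg flatVec (h ⟨z, w⟩)

end ToConnection

end PrincipalBundle

end

/-! ### The one-to-one correspondence -/

theorem mainTheorem4
    {EM : Type*} [NormedAddCommGroup EM] [NormedSpace ℝ EM] [FiniteDimensional ℝ EM]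
    {HM : Type*} [TopologicalSpace HM] (IM : ModelWithCorners ℝ EM HM) [IM.Boundaryless]
    {EP : Type*} [NormedAddCommGroup EP] [NormedSpace ℝ EP] [FiniteDimensional ℝ EP]
    {HP : Type*} [TopologicalSpace HP] (IP : ModelWithCorners ℝ EP HP) [IP.Boundaryless]
    {EG : Type*} [NormedAddCommGroup EG] [NormedSpace ℝ EG] [FiniteDimensional ℝ EG]
    {HG : Type*} [TopologicalSpace HG] (IG : ModelWithCorners ℝ EG HG) [IG.Boundaryless]
    {M : Type*} [TopologicalSpace M] [ChartedSpace HM M] [IsManifold IM ∞ M]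
    {P : Type*} [TopologicalSpace P] [ChartedSpace HP P] [IsManifold IP ∞ P]
    {G : Type*} [TopologicalSpace G] [ChartedSpace HG G] [Group G] [LieGroup IG ∞ G]
    (B : PrincipalBundle IM IP IG M P G) :
    ∃ Φ : B.PrincipalConnection ≃
        {K : VectorValuedOneForm ((IM.prod IM).prod IG) B.GaugeSpace //
          B.gaugeGroupoid.IsMultiplicative IM K ∧
          (∀ W, K.map (K.map W) = K.map W) ∧
          Set.range K.map = B.gaugeVertical},
      ∀ (θ : B.PrincipalConnection) (X Y : TangentBundle IP P),
        (Φ θ).1.map (B.tangentToGauge X Y) =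
          B.tangentToGauge (θ.verticalProjection X) (θ.verticalProjection Y) := by
  refine ⟨Equiv.ofBijective (fun θ => ⟨θ.gaugeForm, θ.isMultiplicative_gaugeForm,
    θ.gaugeForm_gaugeForm, θ.range_gaugeForm⟩) ⟨fun θ θ' h => ?_, ?_⟩,
    fun θ X Y => θ.gaugeForm_tangentToGauge X Y⟩
  · exact PrincipalBundle.PrincipalConnection.gaugeForm_injective (congrArg Subtype.val h)
  · rintro ⟨K, hm, hidem, hrange⟩
    exact ⟨PrincipalBundle.connectionOfForm hidem hrange,
      Subtype.ext (PrincipalBundle.gaugeForm_connectionOfForm hm hidem hrange)⟩
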